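/- Let $\alpha,d>0$ and put $c_*=2\sqrt{d\alpha}$. Let $q_*\in C^2(\mathbb R)$ be a critical front, i.e. $d q_*''+c_*q_*'+\alpha q_*(1-q_*^2)=0$ on $\mathbb R$, $q_*(x)\to1$ as $x\to-\infty$ and $q_*(x)\to0$ as $x\to+\infty$. For $\mu,\gamma>0$ and $\beta\in\mathbb R$ put $$\mathcal A^{\rm kpp}=d\partial_x^2+c_*\partial_x+\alpha(1-3q_*^2),\qquad \mathcal A^{\rm sh}=-(1+\partial_x^2)^2+c_*\partial_x+\mu-\gamma(1-q_*).$$ For $\theta<0$ let $\omega_*=\omega_{\rm kpp}\,\omega_{\rm sh}$, where $\omega_{\rm kpp},\omega_{\rm sh}$ are smooth positive functions with $\omega_{\rm kpp}(x)=1$, $\omega_{\rm sh}(x)=e^{\theta x}$ for $x\le-1$ and $\omega_{\rm kpp}(x)=e^{-\frac{c_*}{2d}x}$, $\omega_{\rm sh}(x)=1$ for $x\ge1$, and let $$\mathcal L=\begin{pmatrix}\omega_*^{-1}\mathcal A^{\rm kpp}\omega_*&\beta\\0&\omega_*^{-1}\mathcal A^{\rm sh}\omega_*\end{pmatrix}$$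 on $L^2(\mathbb R,\mathbb C)^2$ with domain $H^2(\mathbb R,\mathbb C)\times H^4(\mathbb R,\mathbb C)$. Its diagonal blocks have the asymptotic operators $\mathcal L^{\rm kpp,-}=P(\theta+\partial_x)$ with $P(X)=dX^2+c_*X-2\alpha$, and, with $R(X)=-(1+X^2)^2+c_*X+\mu$, $\mathcal L^{\rm sh,-}=R(\theta+\partial_x)$ and $\mathcal L^{\rm sh,+}=R(-\tfrac{c_*}{2d}+\partial_x)-\gamma$, where $\pm$ refers to $x\to\pm\infty$; their spectra $\sigma$ are taken in $L^2(\mathbb R,\mathbb C)$. For $\eta>0$ consider the spectral gap condition $$\sigma(\mathcal L^{\rm kpp,-})\cup\sigma(\mathcal L^{\rm sh,+})\cup\sigma(\mathcal L^{\rm sh,-})\subset\{\lambda\in\mathbb C:\operatorname{Re}\lambda\le-3\eta\}.\tag{G}$$ For $\mu_0>0$ put $\gamma_{\rm rem}=8(\alpha/d)^2+4\alpha/d-2\alpha+\mu_0$. **Proposition.** There is $\bar\mu>0$, depending only on $\alpha,d$, such that for every $0<\mu_0\le\bar\mu$ the following holds. (i) For each $\mu\in(0,\mu_0)$ there is $\theta=\theta(\mu)\in[-\frac{c_*}{2d},0)$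 such that, for every $\gamma>0$ with $\gamma>\gamma_{\rm rem}$, condition (G) holds for all $\mu\in(0,\mu_0)$, with $\theta=\theta(\mu)$ and with some $\eta>0$ that does not depend on $\mu$. (ii) Whenever $0<\mu<\mu_0$, $\gamma>0$, $\gamma>\gamma_{\rm rem}$, $\theta\in[-\frac{c_*}{2d},0)$ and $\eta>0$ satisfy (G), then for every $\beta\in\mathbb R$, every critical front $q_*$ and all weights $\omega_{\rm kpp},\omega_{\rm sh}$ as above, the operator $\mathcal L$ has no eigenvalue in $$\Omega_{\rm eig}=\{\lambda\in\mathbb C:\operatorname{Re}\lambda>-3\eta\}\setminus(-\infty,0).$$ -/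

import Mathlib

open MeasureTheory Filter Topology Polynomial
open scoped ContDiff ENNReal NNReal

noncomputable section

namespace FrontSpectrum

/-- `g` is the `k`-th weak derivative of `u` on the real line. -/
def HasWeakDeriv (k : ℕ) (u g : ℝ → ℂ) : Prop :=
  LocallyIntegrable u ∧ LocallyIntegrable g ∧
    ∀ φ : ℝ → ℝ, ContDiff ℝ ∞ φ → HasCompactSupport φ →
      ∫ x, iteratedDeriv k φ x • u x = (-1 : ℂ) ^ k * ∫ x, φ x • g x

/-- Weak derivatives are unique almost everywhere. -/
theorem HasWeakDeriv.ae_eq {k : ℕ} {u g h : ℝ → ℂ}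
    (hg : HasWeakDeriv k u g) (hh : HasWeakDeriv k u h) : g =ᵐ[volume] h := by
  refine ae_eq_of_integral_contDiff_smul_eq hg.2.1 hh.2.1 fun φ hφ hc => ?_
  have h1 := (hg.2.2 φ hφ hc).symm.trans (hh.2.2 φ hφ hc)
  exact mul_left_cancel₀ (pow_ne_zero k (by norm_num)) h1

open Classical in
/-- The `k`-th weak derivative `∂ₓᵏ u` (well defined up to a null set; it is only meaningful when
a locally integrable weak derivative exists). -/
def weakDeriv (k : ℕ) (u : ℝ → ℂ) : ℝ → ℂ :=
  if h : ∃ g, HasWeakDeriv k u g then h.choose else 0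

theorem weakDeriv_spec {k : ℕ} {u g : ℝ → ℂ} (hg : HasWeakDeriv k u g) :
    HasWeakDeriv k u (weakDeriv k u) := by
  have h : ∃ g, HasWeakDeriv k u g := ⟨g, hg⟩
  simpa only [weakDeriv, dif_pos h] using h.choose_spec

/-- The Sobolev space `Hⁿ(ℝ, ℂ)`: all weak derivatives up to order `n` exist and lie in `L²`. -/
def MemH (n : ℕ) (u : ℝ → ℂ) : Prop :=
  MemLp u 2 ∧ ∀ k ≤ n, ∃ g, MemLp g 2 ∧ HasWeakDeriv k u g

/-- The constant-coefficient differential operator `P(∂ₓ) = ∑ⱼ aⱼ ∂ₓʲ`. -/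
def constOp (P : ℝ[X]) (u : ℝ → ℂ) : ℝ → ℂ :=
  fun x => ∑ j ∈ Finset.range (P.natDegree + 1), (P.coeff j : ℂ) * weakDeriv j u x

/-- `lam - T : Hⁿ(ℝ) ⊂ L²(ℝ) → L²(ℝ)` is boundedly invertible. -/
def InResolventSet (n : ℕ) (T : (ℝ → ℂ) → ℝ → ℂ) (lam : ℂ) : Prop :=
  ∃ C : ℝ≥0, ∀ f : ℝ → ℂ, MemLp f 2 → ∃ u, MemH n u ∧
    (fun x => lam * u x - T u x) =ᵐ[volume] f ∧
    eLpNorm u 2 ≤ C * eLpNorm f 2 ∧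
    ∀ v, MemH n v → (fun x => lam * v x - T v x) =ᵐ[volume] f → v =ᵐ[volume] u

/-- The spectrum of `P(∂ₓ)` as an operator on `L²(ℝ)` with domain `Hⁿ(ℝ)`, `n = deg P`. -/
def constSpectrum (P : ℝ[X]) : Set ℂ :=
  {lam | ¬ InResolventSet P.natDegree (constOp P) lam}

/-- The critical speed `c_* = 2 √(d α)`. -/
def cStar (α d : ℝ) : ℝ := 2 * √(d * α)

/-- `q` is a front of speed `c_*` of `∂ₜu = d ∂ₓₓu + α u (1 - u²)`, which connects `1` at `-∞`
to `0` at `+∞`. -/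
structure IsCriticalFront (α d : ℝ) (q : ℝ → ℝ) : Prop where
  contDiff : ContDiff ℝ 2 q
  ode : ∀ x, d * iteratedDeriv 2 q x + cStar α d * deriv q x + α * q x * (1 - q x ^ 2) = 0
  atBot : Tendsto q atBot (𝓝 1)
  atTop : Tendsto q atTop (𝓝 0)

/-- `A^kpp = d ∂ₓₓ + c_* ∂ₓ + α (1 - 3 q²)`. -/
def opAkpp (α d : ℝ) (q : ℝ → ℝ) (u : ℝ → ℂ) : ℝ → ℂ := fun x =>
  d * weakDeriv 2 u x + cStar α d * weakDeriv 1 u x + (α * (1 - 3 * q x ^ 2) : ℝ) * u x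

/-- `A^sh = -(1 + ∂ₓₓ)² + c_* ∂ₓ + μ - γ (1 - q)`. -/
def opAsh (α d μ γ : ℝ) (q : ℝ → ℝ) (u : ℝ → ℂ) : ℝ → ℂ := fun x =>
  -(weakDeriv 4 u x + 2 * weakDeriv 2 u x + u x) + cStar α d * weakDeriv 1 u x
    + (μ - γ * (1 - q x) : ℝ) * u x

/-- The weight on the KPP side: smooth, positive, `1` for `x ≤ -1` and `e^{-c_* x / (2d)}`
for `x ≥ 1`. -/
structure IsKppWeight (α d : ℝ) (w : ℝ → ℝ) : Prop where
  contDiff : ContDiff ℝ ∞ w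
  pos : ∀ x, 0 < w x
  left : ∀ x ≤ -1, w x = 1
  right : ∀ x ≥ 1, w x = Real.exp (-(cStar α d / (2 * d)) * x)

/-- The weight on the SH side: smooth, positive, `e^{θ x}` for `x ≤ -1` and `1` for `x ≥ 1`. -/
structure IsShWeight (θ : ℝ) (w : ℝ → ℝ) : Prop where
  contDiff : ContDiff ℝ ∞ w
  pos : ∀ x, 0 < w x
  left : ∀ x ≤ -1, w x = Real.exp (θ * x)
  right : ∀ x ≥ 1, w x = 1

/-- The conjugated operator `ω⁻¹ A ω`. -/
def conjOp (w : ℝ → ℝ) (A : (ℝ → ℂ) → ℝ → ℂ) (u : ℝ → ℂ) : ℝ → ℂ := fun x =>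
  ((w x : ℂ))⁻¹ * A (fun y => (w y : ℂ) * u y) x

/-- `L = w⁻¹ A w` with `A = [[A^kpp, β], [0, A^sh]]`. -/
def opL (α β d μ γ : ℝ) (q w : ℝ → ℝ) (φ : (ℝ → ℂ) × (ℝ → ℂ)) : (ℝ → ℂ) × (ℝ → ℂ) :=
  (fun x => conjOp w (opAkpp α d q) φ.1 x + β * φ.2 x, conjOp w (opAsh α d μ γ q) φ.2)

/-- `lam` is an eigenvalue of `L : H²(ℝ) × H⁴(ℝ) ⊂ L²(ℝ)² → L²(ℝ)²`. -/
def IsEigenvalue (L : (ℝ → ℂ) × (ℝ → ℂ) → (ℝ → ℂ) × (ℝ → ℂ)) (lam : ℂ) : Prop :=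
  ∃ φ : (ℝ → ℂ) × (ℝ → ℂ), MemH 2 φ.1 ∧ MemH 4 φ.2 ∧
    ¬ (φ.1 =ᵐ[volume] 0 ∧ φ.2 =ᵐ[volume] 0) ∧
    (L φ).1 =ᵐ[volume] (fun x => lam * φ.1 x) ∧ (L φ).2 =ᵐ[volume] (fun x => lam * φ.2 x)

/-- Symbol of the operator `A^{kpp,-} = d ∂ₓₓ + c_* ∂ₓ - 2α`, the limit of `A^kpp` at `-∞`. -/
def symAkppMinus (α d : ℝ) : ℝ[X] := C d * X ^ 2 + C (cStar α d) * X - C (2 * α)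

/-- Symbol of `A^{sh,-} = -(1 + ∂ₓₓ)² + c_* ∂ₓ + μ`, the limit of `A^sh` at `-∞`. -/
def symAshMinus (α d μ : ℝ) : ℝ[X] := -(1 + X ^ 2) ^ 2 + C (cStar α d) * X + C μ

/-- Symbol of `A^{sh,+} = -(1 + ∂ₓₓ)² + c_* ∂ₓ + μ - γ`, the limit of `A^sh` at `+∞`. -/
def symAshPlus (α d μ γ : ℝ) : ℝ[X] := symAshMinus α d μ - C γ

/-- Symbol of `e^{-τx} P(∂ₓ) e^{τx} = P(τ + ∂ₓ)`. -/
def expConj (τ : ℝ) (P : ℝ[X]) : ℝ[X] := P.comp (X + C τ)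

/-- The spectral gap which defines `η`: the spectra of the asymptotic operators `L^{kpp,-}`,
`L^{sh,+}`, `L^{sh,-}` lie in `{Re ≤ -3η}`. The weight `ω_*` is `e^{θx}` near `-∞` and
`e^{-c_* x / (2d)}` near `+∞`. -/
def SpectralGap (α d μ γ θ η : ℝ) : Prop :=
  constSpectrum (expConj θ (symAkppMinus α d)) ∪
    constSpectrum (expConj (-(cStar α d / (2 * d))) (symAshPlus α d μ γ)) ∪
    constSpectrum (expConj θ (symAshMinus α d μ)) ⊆ {lam : ℂ | lam.re ≤ -3 * η}

/-- `γ_rem = 8 (α/d)² + 4 α/d - 2α + μ₀`. -/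
def gammaRem (α d μ₀ : ℝ) : ℝ := 8 * (α / d) ^ 2 + 4 * (α / d) - 2 * α + μ₀

/-- `{Re lam > -3η} \ (-∞, 0)`. -/
def OmegaEig (η : ℝ) : Set ℂ :=
  {lam | -3 * η < lam.re} \ {lam | lam.im = 0 ∧ lam.re < 0}

end FrontSpectrum

end

open scoped FourierTransform SchwartzMap LineDeriv

namespace FrontSpectrum

/-! ### Calculus of weak derivatives on the line -/

section WeakDerivatives

/-! By Plancherel, the spectrum of `P(∂ₓ)` on `L²` is exactly the range of `P` on the imaginary
axis, so the gap condition says that three symbols have real part at most `-3η`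
(`constSpectrum_subset_iff`, `spectralGap_iff`). For (i) these real parts are bounded by hand. On
`Re X = τ` the Swift-Hohenberg symbol has maximal real part `8τ⁴ + 4τ² + c_* τ + μ`: at the critical
exponent `τ = -c_*/(2d)` this produces `γ_rem`, and at a small `τ = -ε` the term `c_* τ` dominates
and leaves room for a small `μ`.

For (ii) the system is triangular. An eigenfunction times the weight is `e^{τx} v` with `v` in the
same Sobolev space, for every `τ` between the two weight exponents (`MemH.weight_eq_exp_mul`). With
`τ = θ`, the second component satisfies `R(θ + ∂ₓ) v = (λ + γ (1 - q)) v`. Since `q ≤ 1`, the right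
side has quadratic form with real part at least `Re λ ‖v‖²`, whereas the symbol stays strictly to
the left of `Re λ`; hence `v = 0`. The coupling then disappears, and with `τ = -c_*/(2d)` the first
component satisfies `d v'' - 3α q² v = λ v`: a symmetric nonpositive operator without kernel, whose
eigenvalues are therefore negative reals. Both energy arguments are instances of
`eq_zero_of_symbol_lt`. -/

theorem HasWeakDeriv.congr_ae {k : ℕ} {u g u' g' : ℝ → ℂ} (h : HasWeakDeriv k u g)
    (hu : u =ᵐ[volume] u') (hg : g =ᵐ[volume] g') : HasWeakDeriv k u' g' := by
  have hloc : ∀ {a b : ℝ → ℂ}, a =ᵐ[volume] b → LocallyIntegrable a → LocallyIntegrable b :=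
    fun hab ha x => by
      obtain ⟨s, hs, hi⟩ := ha x
      exact ⟨s, hs, hi.congr_fun_ae (ae_restrict_of_ae hab)⟩
  refine ⟨hloc hu h.1, hloc hg h.2.1, fun φ hφ hc => ?_⟩
  have h1 : ∫ x, iteratedDeriv k φ x • u' x = ∫ x, iteratedDeriv k φ x • u x :=
    integral_congr_ae (hu.mono fun x hx => by simp only [hx])
  have h2 : ∫ x, φ x • g' x = ∫ x, φ x • g x :=
    integral_congr_ae (hg.mono fun x hx => by simp only [hx])
  rw [h1, h2, h.2.2 φ hφ hc]

theorem hasWeakDeriv_zero {u : ℝ → ℂ} (hu : LocallyIntegrable u) : HasWeakDeriv 0 u u :=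
  ⟨hu, hu, fun φ _ _ => by simp⟩

theorem hasCompactSupport_iteratedDeriv {φ : ℝ → ℝ} (hc : HasCompactSupport φ) (k : ℕ) :
    HasCompactSupport (iteratedDeriv k φ) := by
  induction k with
  | zero => simpa using hc
  | succ k ih => rw [iteratedDeriv_succ]; exact ih.deriv

theorem contDiff_iteratedDeriv {φ : ℝ → ℝ} (hφ : ContDiff ℝ ∞ φ) (k : ℕ) :
    ContDiff ℝ ∞ (iteratedDeriv k φ) := by
  rw [iteratedDeriv_eq_iterate]
  exact hφ.iterate_deriv k

theorem HasWeakDeriv.of_succ {k : ℕ} {u g h : ℝ → ℂ} (hg : HasWeakDeriv k u g)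
    (hh : HasWeakDeriv (k + 1) u h) : HasWeakDeriv 1 g h := by
  refine ⟨hg.2.1, hh.2.1, fun φ hφ hc => ?_⟩
  have h1 := hg.2.2 (deriv φ) (contDiff_infty_iff_deriv.1 hφ).2 hc.deriv
  have h2 := hh.2.2 φ hφ hc
  rw [iteratedDeriv_succ'] at h2
  rw [h2, pow_succ, mul_assoc] at h1
  rw [iteratedDeriv_one, pow_one]
  exact (mul_left_cancel₀ (pow_ne_zero k (by norm_num)) h1).symm

theorem HasWeakDeriv.succ {k : ℕ} {u g h : ℝ → ℂ} (hg : HasWeakDeriv k u g)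
    (hh : HasWeakDeriv 1 g h) : HasWeakDeriv (k + 1) u h := by
  refine ⟨hg.1, hh.2.1, fun φ hφ hc => ?_⟩
  have h1 := hg.2.2 (deriv φ) (contDiff_infty_iff_deriv.1 hφ).2 hc.deriv
  have h2 := hh.2.2 φ hφ hc
  rw [iteratedDeriv_one, pow_one] at h2
  rw [iteratedDeriv_succ', h1, h2, pow_succ, mul_assoc]

theorem HasWeakDeriv.one_comp {k : ℕ} {u g h : ℝ → ℂ} (hg : HasWeakDeriv 1 u g)
    (hh : HasWeakDeriv k g h) : HasWeakDeriv (k + 1) u h := by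
  refine ⟨hg.1, hh.2.1, fun φ hφ hc => ?_⟩
  have h1 := hg.2.2 _ (contDiff_iteratedDeriv hφ k) (hasCompactSupport_iteratedDeriv hc k)
  have h2 := hh.2.2 φ hφ hc
  rw [iteratedDeriv_one, h2] at h1
  rw [iteratedDeriv_succ, h1, pow_succ]
  ring

theorem HasWeakDeriv.add {k : ℕ} {u g v h : ℝ → ℂ} (hu : HasWeakDeriv k u g)
    (hv : HasWeakDeriv k v h) : HasWeakDeriv k (fun x => u x + v x) fun x => g x + h x := by
  refine ⟨hu.1.add hv.1, hu.2.1.add hv.2.1, fun φ hφ hc => ?_⟩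
  have hint : ∀ {w : ℝ → ℂ} {ψ : ℝ → ℝ}, LocallyIntegrable w → ContDiff ℝ ∞ ψ →
      HasCompactSupport ψ → Integrable (fun x => ψ x • w x) := fun hw hψ hcψ =>
    hw.integrable_smul_left_of_hasCompactSupport hψ.continuous hcψ
  have hk := contDiff_iteratedDeriv hφ k
  have hck := hasCompactSupport_iteratedDeriv hc k
  simp only [smul_add]
  rw [integral_add (hint hu.1 hk hck) (hint hv.1 hk hck),
    integral_add (hint hu.2.1 hφ hc) (hint hv.2.1 hφ hc), hu.2.2 φ hφ hc, hv.2.2 φ hφ hc]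
  ring

/-- Leibniz rule for a weak derivative and a smooth factor. -/
theorem HasWeakDeriv.mul_smooth {u g : ℝ → ℂ} {m : ℝ → ℝ} (hm : ContDiff ℝ ∞ m)
    (h : HasWeakDeriv 1 u g) :
    HasWeakDeriv 1 (fun x => (m x : ℂ) * u x)
      fun x => ((deriv m x : ℝ) : ℂ) * u x + (m x : ℂ) * g x := by
  have hm' : ContDiff ℝ ∞ (deriv m) := (contDiff_infty_iff_deriv.1 hm).2
  have hloc : ∀ {w : ℝ → ℂ} {ψ : ℝ → ℝ}, LocallyIntegrable w → ContDiff ℝ ∞ ψ →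
      LocallyIntegrable (fun x => (ψ x : ℂ) * w x) := fun hw hψ => by
    simpa only [Complex.real_smul] using hw.continuous_smul hψ.continuous
  have hint : ∀ {w : ℝ → ℂ} {ψ : ℝ → ℝ}, LocallyIntegrable w → ContDiff ℝ ∞ ψ →
      HasCompactSupport ψ → Integrable (fun x => ψ x • w x) := fun hw hψ hcψ =>
    hw.integrable_smul_left_of_hasCompactSupport hψ.continuous hcψ
  refine ⟨hloc h.1 hm, (hloc h.1 hm').add (hloc h.2.1 hm), fun φ hφ hc => ?_⟩
  have hφ' : ContDiff ℝ ∞ (deriv φ) := (contDiff_infty_iff_deriv.1 hφ).2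
  -- The smooth factor is moved onto the test function, where the classical product rule applies.
  have key := h.2.2 (fun x => φ x * m x) (hφ.mul hm) hc.mul_right
  have hd : ∀ x, deriv (fun x => φ x * m x) x = deriv φ x * m x + φ x * deriv m x := fun x =>
    deriv_fun_mul (hφ.differentiable (by simp) x) (hm.differentiable (by simp) x)
  simp only [iteratedDeriv_one, hd, add_smul] at key
  rw [integral_add (hint h.1 (hφ'.mul hm) hc.deriv.mul_right)
    (hint h.1 (hφ.mul hm') hc.mul_right)] at key
  simp only [iteratedDeriv_one]
  have e1 : ∫ x, deriv φ x • ((m x : ℂ) * u x) = ∫ x, (deriv φ x * m x) • u x := by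
    congr 1; ext x; simp only [Complex.real_smul]; push_cast; ring
  have e2 : ∫ x, φ x • (((deriv m x : ℝ) : ℂ) * u x + (m x : ℂ) * g x)
      = (∫ x, (φ x * deriv m x) • u x) + ∫ x, (φ x * m x) • g x := by
    rw [← integral_add (hint h.1 (hφ.mul hm') hc.mul_right)
      (hint h.2.1 (hφ.mul hm) hc.mul_right)]
    congr 1; ext x; simp only [Complex.real_smul]; push_cast; ring
  rw [e1, e2]
  linear_combination key

end WeakDerivatives

/-! ### Weak derivatives under the Fourier transform -/

section Fourier

/-- Weak differentiability in `L²` may be tested against Schwartz functions. -/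
theorem HasWeakDeriv.integral_schwartz {u g : Lp ℂ 2 (volume : Measure ℝ)}
    (h : HasWeakDeriv 1 u g) (ψ : 𝓢(ℝ, ℂ)) :
    ∫ x, deriv ψ x * u x = - ∫ x, ψ x * g x := by
  -- complex-valued test functions
  have hcpt : ∀ φ : ℝ → ℂ, ContDiff ℝ ∞ φ → HasCompactSupport φ →
      ∫ x, deriv φ x * u x = - ∫ x, φ x * g x := by
    intro φ hφ hc
    have hre : ContDiff ℝ ∞ (fun x => (φ x).re) := Complex.reCLM.contDiff.comp hφ
    have him : ContDiff ℝ ∞ (fun x => (φ x).im) := Complex.imCLM.contDiff.comp hφ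
    have hcre : HasCompactSupport (fun x => (φ x).re) := hc.comp_left (g := Complex.re) rfl
    have hcim : HasCompactSupport (fun x => (φ x).im) := hc.comp_left (g := Complex.im) rfl
    have h1 := h.2.2 _ hre hcre
    have h2 := h.2.2 _ him hcim
    have hdiff : ∀ x, HasDerivAt φ (deriv φ x) x := fun x =>
      (hφ.differentiable (by simp) x).hasDerivAt
    have dre : ∀ x, deriv (fun x => (φ x).re) x = (deriv φ x).re := fun x =>
      (Complex.reCLM.hasFDerivAt.comp_hasDerivAt x (hdiff x)).deriv
    have dim : ∀ x, deriv (fun x => (φ x).im) x = (deriv φ x).im := fun x =>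
      (Complex.imCLM.hasFDerivAt.comp_hasDerivAt x (hdiff x)).deriv
    have hint : ∀ {w : ℝ → ℂ} {ψ : ℝ → ℝ}, LocallyIntegrable w → ContDiff ℝ ∞ ψ →
        HasCompactSupport ψ → Integrable (fun x => ψ x • w x) := fun hw hψ hcψ =>
      hw.integrable_smul_left_of_hasCompactSupport hψ.continuous hcψ
    have i1 := hint h.1 (contDiff_infty_iff_deriv.1 hre).2 hcre.deriv
    have i2 := hint h.1 (contDiff_infty_iff_deriv.1 him).2 hcim.deriv
    have i3 := hint h.2.1 hre hcre
    have i4 := hint h.2.1 him hcim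
    simp only [iteratedDeriv_one, pow_one] at h1 h2
    have e1 : ∫ x, deriv φ x * u x = (∫ x, deriv (fun x => (φ x).re) x • u x)
        + Complex.I * ∫ x, deriv (fun x => (φ x).im) x • u x := by
      rw [← integral_const_mul, ← integral_add i1 (i2.const_mul _)]
      congr 1; ext x
      simp only [dre, dim, Complex.real_smul]
      conv_lhs => rw [← Complex.re_add_im (deriv φ x)]
      ring
    have e2 : ∫ x, φ x * g x = (∫ x, (φ x).re • g x) + Complex.I * ∫ x, (φ x).im • g x := by
      rw [← integral_const_mul, ← integral_add i3 (i4.const_mul _)]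
      congr 1; ext x
      simp only [Complex.real_smul]
      conv_lhs => rw [← Complex.re_add_im (φ x)]
      ring
    rw [e1, e2, h1, h2]; ring
  -- cut-offs
  let χ : ContDiffBump (0 : ℝ) := ⟨1, 2, one_pos, one_lt_two⟩
  have hχ : ContDiff ℝ ∞ (χ : ℝ → ℝ) := χ.contDiff
  have hχc : HasCompactSupport (χ : ℝ → ℝ) := χ.hasCompactSupport
  obtain ⟨K, hK⟩ := (hχ.continuous_deriv (by simp)).bounded_above_of_compact_support hχc.deriv
  have hK0 : 0 ≤ K := (norm_nonneg _).trans (hK 0)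
  let ε : ℕ → ℝ := fun n => 1 / ((n : ℝ) + 1)
  have hε0 : ∀ n, 0 < ε n := fun n => by positivity
  have hε1 : ∀ n, ε n ≤ 1 := fun n => by
    simp only [ε]; rw [div_le_one (by positivity)]; linarith [Nat.cast_nonneg (α := ℝ) n]
  have hεt : Tendsto ε atTop (𝓝 0) := tendsto_one_div_add_atTop_nhds_zero_nat
  have hψ : ContDiff ℝ ∞ (ψ : ℝ → ℂ) := ψ.smooth ⊤
  have hψ2 : MemLp ψ 2 (volume : Measure ℝ) := ψ.memLp 2
  have hdψ2 : MemLp (deriv ψ) 2 (volume : Measure ℝ) := by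
    have := (SchwartzMap.derivCLM ℂ ℂ ψ).memLp 2
    rwa [show ⇑(SchwartzMap.derivCLM ℂ ℂ ψ) = deriv ψ from
      funext fun x => SchwartzMap.derivCLM_apply ℂ ψ x] at this
  have Ig : Integrable fun x => ψ x * g x := hψ2.integrable_mul (Lp.memLp g)
  have Iu : Integrable fun x => ψ x * u x := hψ2.integrable_mul (Lp.memLp u)
  have Iu' : Integrable fun x => deriv ψ x * u x := hdψ2.integrable_mul (Lp.memLp u)
  have hcut : ∀ n, ContDiff ℝ ∞ fun x : ℝ => ((χ (ε n * x) : ℝ) : ℂ) := fun n =>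
    Complex.ofRealCLM.contDiff.comp (hχ.comp (contDiff_const.mul contDiff_id))
  have hcutd : ∀ n x, HasDerivAt (fun x : ℝ => ((χ (ε n * x) : ℝ) : ℂ))
      (((ε n * deriv χ (ε n * x) : ℝ)) : ℂ) x := fun n x => by
    have h1 : HasDerivAt (fun x : ℝ => ε n * x) (ε n) x := by
      simpa using (hasDerivAt_id x).const_mul (ε n)
    have h2 := ((hχ.differentiable (by simp) (ε n * x)).hasDerivAt.comp x h1).ofReal_comp
    rw [mul_comm]
    exact h2
  have hlim0 : ∀ x, Tendsto (fun n => χ (ε n * x)) atTop (𝓝 1) := fun x => by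
    have h1 : Tendsto (fun n => ε n * x) atTop (𝓝 0) := by simpa using hεt.mul_const x
    have h2 := (hχ.continuous.tendsto 0).comp h1
    rwa [show χ 0 = 1 from χ.one_of_mem_closedBall (by simp [χ])] at h2
  have hlim1 : ∀ x, Tendsto (fun n => ε n * deriv χ (ε n * x)) atTop (𝓝 0) := fun x => by
    refine squeeze_zero_norm (a := fun n => ε n * K) (fun n => ?_) (by simpa using hεt.mul_const K)
    rw [norm_mul, Real.norm_of_nonneg (hε0 n).le]
    exact mul_le_mul_of_nonneg_left (hK _) (hε0 n).le
  have heq : ∀ n, ∫ x, (((ε n * deriv χ (ε n * x) : ℝ) : ℂ) * (ψ x * u x)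
      + ((χ (ε n * x) : ℝ) : ℂ) * (deriv ψ x * u x))
      = - ∫ x, ((χ (ε n * x) : ℝ) : ℂ) * (ψ x * g x) := by
    intro n
    have hc : HasCompactSupport fun x : ℝ => ((χ (ε n * x) : ℝ) : ℂ) := by
      have : HasCompactSupport fun x : ℝ => χ (ε n * x) :=
        hχc.comp_homeomorph (Homeomorph.mulLeft₀ (ε n) (hε0 n).ne')
      exact this.comp_left (g := ((↑) : ℝ → ℂ)) rfl
    have := hcpt (fun x => ((χ (ε n * x) : ℝ) : ℂ) * ψ x) ((hcut n).mul hψ) hc.mul_right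
    have hd : ∀ x, deriv (fun x => ((χ (ε n * x) : ℝ) : ℂ) * ψ x) x
        = ((ε n * deriv χ (ε n * x) : ℝ) : ℂ) * ψ x + ((χ (ε n * x) : ℝ) : ℂ) * deriv ψ x :=
      fun x => ((hcutd n x).mul (ψ.hasDerivAt x)).deriv
    simp only [hd] at this
    convert this using 2
    · ext x; ring
    · congr 1; ext x; ring
  have hcd : ∀ n, Continuous fun x : ℝ => ((ε n * deriv χ (ε n * x) : ℝ) : ℂ) := fun n =>
    Complex.continuous_ofReal.comp (continuous_const.mul
      ((hχ.continuous_deriv (by simp)).comp (continuous_const.mul continuous_id)))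
  have hχ1 : ∀ y, ‖((χ y : ℝ) : ℂ)‖ ≤ 1 := fun y => by
    rw [Complex.norm_real, Real.norm_of_nonneg χ.nonneg]; exact χ.le_one
  -- Dominated convergence: `ε n ≤ 1` and `|χ'| ≤ K` give a majorant independent of `n`, and the
  -- term carrying the derivative of the cut-off vanishes in the limit.
  have T1 : Tendsto (fun n => ∫ x, (((ε n * deriv χ (ε n * x) : ℝ) : ℂ) * (ψ x * u x)
      + ((χ (ε n * x) : ℝ) : ℂ) * (deriv ψ x * u x))) atTop (𝓝 (∫ x, deriv ψ x * u x)) := by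
    refine tendsto_integral_of_dominated_convergence
      (fun x => K * ‖ψ x * u x‖ + ‖deriv ψ x * u x‖) (fun n => ?_)
      ((Iu.norm.const_mul K).add Iu'.norm) (fun n => ae_of_all _ fun x => ?_)
      (ae_of_all _ fun x => ?_)
    · exact ((hcd n).aestronglyMeasurable.mul Iu.aestronglyMeasurable).add
        ((hcut n).continuous.aestronglyMeasurable.mul Iu'.aestronglyMeasurable)
    · refine (norm_add_le _ _).trans (add_le_add ?_ ?_)
      · rw [norm_mul]
        refine mul_le_mul_of_nonneg_right ?_ (norm_nonneg _)
        rw [Complex.norm_real, norm_mul, Real.norm_of_nonneg (hε0 n).le]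
        exact (mul_le_mul (hε1 n) (hK _) (norm_nonneg _) zero_le_one).trans (one_mul K).le
      · rw [norm_mul]
        exact mul_le_of_le_one_left (norm_nonneg _) (hχ1 _)
    · have a := ((Complex.continuous_ofReal.tendsto 0).comp (hlim1 x)).mul_const (ψ x * u x)
      have b := ((Complex.continuous_ofReal.tendsto 1).comp (hlim0 x)).mul_const (deriv ψ x * u x)
      simpa using a.add b
  have T2 : Tendsto (fun n => - ∫ x, ((χ (ε n * x) : ℝ) : ℂ) * (ψ x * g x)) atTop
      (𝓝 (- ∫ x, ψ x * g x)) := by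
    refine (tendsto_integral_of_dominated_convergence (fun x => ‖ψ x * g x‖) (fun n => ?_)
      Ig.norm (fun n => ae_of_all _ fun x => ?_) (ae_of_all _ fun x => ?_)).neg
    · exact (hcut n).continuous.aestronglyMeasurable.mul Ig.aestronglyMeasurable
    · rw [norm_mul]
      exact mul_le_of_le_one_left (norm_nonneg _) (hχ1 _)
    · simpa using
        ((Complex.continuous_ofReal.tendsto 1).comp (hlim0 x)).mul_const (ψ x * g x)
  simp only [heq] at T1
  exact tendsto_nhds_unique T1 T2

theorem locallyIntegrable_Lp (u : Lp ℂ 2 (volume : Measure ℝ)) : LocallyIntegrable u :=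
  (Lp.memLp u).locallyIntegrable (by norm_num)

/-- The derivative of an `L²` function in the sense of tempered distributions. -/
theorem hasWeakDeriv_one_iff_lineDeriv {u g : Lp ℂ 2 (volume : Measure ℝ)} :
    HasWeakDeriv 1 u g ↔ ∂_{(1 : ℝ)} (u : 𝓢'(ℝ, ℂ)) = (g : 𝓢'(ℝ, ℂ)) := by
  constructor
  · intro h
    ext ψ
    have := h.integral_schwartz ψ
    simp only [TemperedDistribution.lineDerivOp_apply_apply, map_neg,
      Lp.toTemperedDistribution_apply, SchwartzMap.lineDerivOp_apply_eq_fderiv, smul_eq_mul]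
    simp only [fderiv_apply_one_eq_deriv]
    rw [this, neg_neg]
  · intro h
    refine ⟨locallyIntegrable_Lp u, locallyIntegrable_Lp g, fun φ hφ hc => ?_⟩
    have hφ' : ContDiff ℝ ∞ fun x => (φ x : ℂ) := Complex.ofRealCLM.contDiff.comp hφ
    have hc' : HasCompactSupport fun x => (φ x : ℂ) := hc.comp_left (g := ((↑) : ℝ → ℂ)) rfl
    have := congrArg (fun T : 𝓢'(ℝ, ℂ) => T (hc'.toSchwartzMap hφ')) h
    simp only [TemperedDistribution.lineDerivOp_apply_apply, map_neg,
      Lp.toTemperedDistribution_apply, SchwartzMap.lineDerivOp_apply_eq_fderiv, smul_eq_mul] at this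
    simp only [fderiv_apply_one_eq_deriv] at this
    have hd : ∀ x, deriv (hc'.toSchwartzMap hφ') x = ((deriv φ x : ℝ) : ℂ) := fun x =>
      ((hφ.differentiable (by simp) x).hasDerivAt.ofReal_comp).deriv
    simp only [hd] at this
    simp only [iteratedDeriv_one, Complex.real_smul, pow_one]
    rw [neg_one_mul, ← neg_eq_iff_eq_neg]
    exact this

/-- On the Fourier side, the weak derivative is multiplication by `2πiξ`. -/
theorem hasWeakDeriv_one_iff_fourier {u g : Lp ℂ 2 (volume : Measure ℝ)} :
    HasWeakDeriv 1 u g ↔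
      (𝓕 g : Lp ℂ 2 (volume : Measure ℝ)) =ᵐ[volume]
        fun ξ => (2 * Real.pi * Complex.I * ξ) * (𝓕 u : Lp ℂ 2 (volume : Measure ℝ)) ξ := by
  have hgrowth : Function.HasTemperateGrowth fun ξ : ℝ => ((inner ℝ ξ (1 : ℝ) : ℝ) : ℂ) := by
    fun_prop
  have happ : ∀ ψ : 𝓢(ℝ, ℂ), (𝓕 (∂_{(1 : ℝ)} (u : 𝓢'(ℝ, ℂ))) : 𝓢'(ℝ, ℂ)) ψ
      = ∫ ξ, ψ ξ * ((2 * Real.pi * Complex.I * ξ) *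
        (𝓕 u : Lp ℂ 2 (volume : Measure ℝ)) ξ) := by
    intro ψ
    rw [TemperedDistribution.fourier_lineDerivOp_eq, Lp.fourier_toTemperedDistribution_eq]
    simp only [_root_.smul_apply, TemperedDistribution.smulLeftCLM_apply_apply,
      Lp.toTemperedDistribution_apply, smul_eq_mul]
    rw [← integral_const_mul]
    congr 1; ext ξ
    rw [SchwartzMap.smulLeftCLM_apply_apply hgrowth]
    simp
    ring
  have hgapp : ∀ ψ : 𝓢(ℝ, ℂ), (𝓕 (g : 𝓢'(ℝ, ℂ)) : 𝓢'(ℝ, ℂ)) ψ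
      = ∫ ξ, ψ ξ * (𝓕 g : Lp ℂ 2 (volume : Measure ℝ)) ξ := by
    intro ψ
    rw [Lp.fourier_toTemperedDistribution_eq]
    simp
  rw [hasWeakDeriv_one_iff_lineDeriv]
  constructor
  · intro h
    have hl : LocallyIntegrable fun ξ : ℝ =>
        (2 * Real.pi * Complex.I * ξ) * (𝓕 u : Lp ℂ 2 (volume : Measure ℝ)) ξ := by
      simpa only [smul_eq_mul] using (locallyIntegrable_Lp (𝓕 u)).continuous_smul
        (g := fun ξ : ℝ => 2 * Real.pi * Complex.I * (ξ : ℂ)) (by fun_prop)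
    refine ae_eq_of_integral_contDiff_smul_eq (locallyIntegrable_Lp _) hl fun φ hφ hc => ?_
    have hφ' : ContDiff ℝ ∞ fun x => (φ x : ℂ) := Complex.ofRealCLM.contDiff.comp hφ
    have hc' : HasCompactSupport fun x => (φ x : ℂ) := hc.comp_left (g := ((↑) : ℝ → ℂ)) rfl
    have h1 := happ (hc'.toSchwartzMap hφ')
    rw [h, hgapp] at h1
    simp only [Complex.real_smul]
    exact h1
  · intro h
    have : 𝓕 (∂_{(1 : ℝ)} (u : 𝓢'(ℝ, ℂ))) = 𝓕 (g : 𝓢'(ℝ, ℂ)) := by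
      ext ψ
      rw [happ, hgapp]
      refine integral_congr_ae (h.mono fun ξ hξ => ?_)
      simp only [hξ]
    have h2 := congrArg (fun T : 𝓢'(ℝ, ℂ) => 𝓕⁻ T) this
    simpa only [FourierTransform.fourierInv_fourier_eq] using h2

end Fourier

/-! ### Spectra of constant-coefficient operators -/

section Symbols

/-- The space `L²(ℝ, ℂ)`. -/
noncomputable abbrev L2 := Lp ℂ 2 (volume : Measure ℝ)

/-- The symbol `2πiξ` of `∂ₓ`. -/
noncomputable def freq (ξ : ℝ) : ℂ := 2 * Real.pi * Complex.I * ξ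

theorem continuous_freq : Continuous freq := by
  unfold freq; fun_prop

theorem continuous_aeval_freq (P : ℝ[X]) : Continuous fun ξ => aeval (freq ξ) P := by
  have h : ∀ z : ℂ, aeval z P = (P.map (algebraMap ℝ ℂ)).eval z := fun z => by simp [aeval_def]
  simp only [h]
  exact (P.map (algebraMap ℝ ℂ)).continuous.comp continuous_freq

/-- A derivative in `L²` in terms of its Fourier transform. -/
theorem MemH.exists_fourier {n : ℕ} {u : ℝ → ℂ} (h : MemH n u) (k : ℕ) (hk : k ≤ n) :
    ∃ G : L2, HasWeakDeriv k u G ∧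
      (𝓕 G : L2) =ᵐ[volume] fun ξ => freq ξ ^ k * (𝓕 (h.1.toLp u) : L2) ξ := by
  induction k with
  | zero =>
    refine ⟨h.1.toLp u, ?_, by simp⟩
    exact (hasWeakDeriv_zero (h.1.locallyIntegrable (by norm_num))).congr_ae .rfl
      h.1.coeFn_toLp.symm
  | succ k ih =>
    obtain ⟨G, hG, hF⟩ := ih (by omega)
    obtain ⟨g, hg2, hg⟩ := h.2 (k + 1) hk
    have hg' : HasWeakDeriv (k + 1) u (hg2.toLp g) := hg.congr_ae .rfl hg2.coeFn_toLp.symm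
    refine ⟨hg2.toLp g, hg', ?_⟩
    have h1 := hasWeakDeriv_one_iff_fourier.1 (hG.of_succ hg')
    filter_upwards [h1, hF] with ξ h1 h2
    rw [h1, h2, pow_succ, freq]
    ring

/-- Sobolev regularity from decay of the Fourier transform. -/
theorem memH_of_fourier {n : ℕ} (U : L2)
    (h : ∀ k ≤ n, MemLp (fun ξ => freq ξ ^ k * (𝓕 U : L2) ξ) 2 (volume : Measure ℝ)) :
    MemH n U := by
  have key : ∀ k ≤ n, ∃ G : L2, HasWeakDeriv k U G ∧
      (𝓕 G : L2) =ᵐ[volume] fun ξ => freq ξ ^ k * (𝓕 U : L2) ξ := by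
    intro k
    induction k with
    | zero => exact fun _ => ⟨U, hasWeakDeriv_zero (locallyIntegrable_Lp U), by simp⟩
    | succ k ih =>
      intro hk
      obtain ⟨G, hG, hF⟩ := ih (by omega)
      have hF' : (𝓕 (𝓕⁻ ((h (k + 1) hk).toLp _) : L2) : L2) =ᵐ[volume]
          fun ξ => freq ξ ^ (k + 1) * (𝓕 U : L2) ξ := by
        rw [FourierTransform.fourier_fourierInv_eq]
        exact (h (k + 1) hk).coeFn_toLp
      refine ⟨𝓕⁻ ((h (k + 1) hk).toLp _), hG.succ (hasWeakDeriv_one_iff_fourier.2 ?_), hF'⟩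
      filter_upwards [hF', hF] with ξ h1 h2
      rw [h1, h2, pow_succ, freq]
      ring
  refine ⟨Lp.memLp U, fun k hk => ?_⟩
  obtain ⟨G, hG, -⟩ := key k hk
  exact ⟨G, Lp.memLp G, hG⟩

theorem coeFn_sum_smul {ι : Type*} (s : Finset ι) (c : ι → ℂ) (G : ι → L2) :
    (∑ j ∈ s, c j • G j : L2) =ᵐ[volume] fun x => ∑ j ∈ s, c j * G j x := by
  have h : ∀ᵐ x, ∀ j ∈ s, (c j • G j : L2) x = c j * G j x := by
    rw [Filter.eventually_all_finset]
    exact fun j _ => (Lp.coeFn_smul (c j) (G j)).mono fun x hx => by simp [hx]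
  filter_upwards [Lp.coeFn_finsetSum s fun j => c j • G j, h] with x h1 h2
  rw [h1, Finset.sum_apply]
  exact Finset.sum_congr rfl h2

theorem fourier_sum_smul {ι : Type*} (s : Finset ι) (c : ι → ℂ) (G : ι → L2) :
    (𝓕 (∑ j ∈ s, c j • G j : L2) : L2) = ∑ j ∈ s, c j • (𝓕 (G j) : L2) := by
  change Lp.fourierTransformₗᵢ ℝ ℂ (∑ j ∈ s, c j • G j) = _
  rw [map_sum]
  exact Finset.sum_congr rfl fun j _ => map_smul (Lp.fourierTransformₗᵢ ℝ ℂ) (c j) (G j)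

/-- A constant-coefficient differential operator is a Fourier multiplier. -/
theorem MemH.exists_constOp {P : ℝ[X]} {u : ℝ → ℂ} (h : MemH P.natDegree u) :
    ∃ G : L2, constOp P u =ᵐ[volume] G ∧
      (𝓕 G : L2) =ᵐ[volume] fun ξ => aeval (freq ξ) P * (𝓕 (h.1.toLp u) : L2) ξ := by
  have h1 : ∀ k, ∃ G : L2, k ≤ P.natDegree → HasWeakDeriv k u G ∧
      (𝓕 G : L2) =ᵐ[volume] fun ξ => freq ξ ^ k * (𝓕 (h.1.toLp u) : L2) ξ := fun k => by
    by_cases hk : k ≤ P.natDegree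
    · obtain ⟨G, hG⟩ := h.exists_fourier k hk
      exact ⟨G, fun _ => hG⟩
    -- Junk value above the degree, so that `choose` yields a family over all `k`.
    · exact ⟨0, fun h => absurd h hk⟩
  choose G hG using h1
  refine ⟨∑ j ∈ Finset.range (P.natDegree + 1), (P.coeff j : ℂ) • G j, ?_, ?_⟩
  · have h2 : ∀ᵐ x, ∀ j ∈ Finset.range (P.natDegree + 1), weakDeriv j u x = G j x := by
      rw [Filter.eventually_all_finset]
      intro j hj
      have := (hG j (Nat.lt_succ_iff.1 (Finset.mem_range.1 hj))).1
      exact (weakDeriv_spec this).ae_eq this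
    filter_upwards [h2, coeFn_sum_smul (Finset.range (P.natDegree + 1))
      (fun j => (P.coeff j : ℂ)) G] with x hx hs
    rw [hs, constOp]
    exact Finset.sum_congr rfl fun j hj => by rw [hx j hj]
  · rw [fourier_sum_smul]
    have h2 : ∀ᵐ ξ, ∀ j ∈ Finset.range (P.natDegree + 1), (𝓕 (G j) : L2) ξ =
        freq ξ ^ j * (𝓕 (h.1.toLp u) : L2) ξ := by
      rw [Filter.eventually_all_finset]
      exact fun j hj => (hG j (Nat.lt_succ_iff.1 (Finset.mem_range.1 hj))).2
    filter_upwards [h2, coeFn_sum_smul (Finset.range (P.natDegree + 1))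
      (fun j => (P.coeff j : ℂ)) fun j => 𝓕 (G j)] with ξ hx hs
    rw [hs, aeval_eq_sum_range, Finset.sum_mul]
    refine Finset.sum_congr rfl fun j hj => ?_
    rw [hx j hj, Complex.real_smul]
    ring

theorem fourier_injective {f g : L2} (h : (𝓕 f : L2) =ᵐ[volume] (𝓕 g : L2)) : f = g :=
  (Lp.fourierTransformₗᵢ ℝ ℂ).injective (Lp.ext h)

theorem eLpNorm_fourier (f : L2) :
    eLpNorm (𝓕 f : L2) 2 (volume : Measure ℝ) = eLpNorm f 2 (volume : Measure ℝ) := by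
  rw [← Lp.enorm_def, ← Lp.enorm_def, ← ofReal_norm, ← ofReal_norm, Lp.norm_fourier_eq]

/-- The resolvent equation of a constant-coefficient operator on the Fourier side. -/
theorem resolvent_eq_iff {P : ℝ[X]} {u : ℝ → ℂ} (h : MemH P.natDegree u) (lam : ℂ) (F : L2) :
    (fun x => lam * u x - constOp P u x) =ᵐ[volume] F ↔
      (𝓕 F : L2) =ᵐ[volume] fun ξ => (lam - aeval (freq ξ) P) * (𝓕 (h.1.toLp u) : L2) ξ := by
  obtain ⟨G, hG, hGF⟩ := h.exists_constOp
  have h1 : (lam • h.1.toLp u - G : L2) =ᵐ[volume] fun x => lam * u x - constOp P u x := by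
    filter_upwards [Lp.coeFn_sub (lam • h.1.toLp u) G, Lp.coeFn_smul lam (h.1.toLp u),
      h.1.coeFn_toLp, hG] with x a b c e
    rw [a, Pi.sub_apply, b, Pi.smul_apply, c, e, smul_eq_mul]
  have h2 : (𝓕 (lam • h.1.toLp u - G : L2) : L2) =ᵐ[volume]
      fun ξ => (lam - aeval (freq ξ) P) * (𝓕 (h.1.toLp u) : L2) ξ := by
    have e : (𝓕 (lam • h.1.toLp u - G : L2) : L2) = lam • 𝓕 (h.1.toLp u) - 𝓕 G := by
      change Lp.fourierTransformₗᵢ ℝ ℂ _ = _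
      rw [map_sub, map_smul]
      rfl
    rw [e]
    filter_upwards [Lp.coeFn_sub (lam • (𝓕 (h.1.toLp u) : L2)) (𝓕 G),
      Lp.coeFn_smul lam (𝓕 (h.1.toLp u) : L2), hGF] with ξ a b c
    rw [a, Pi.sub_apply, b, Pi.smul_apply, c, smul_eq_mul]
    ring
  constructor
  · intro hF
    have : F = lam • h.1.toLp u - G := Lp.ext (hF.symm.trans h1.symm)
    rw [this]
    exact h2
  · intro hF
    rw [fourier_injective (hF.trans h2.symm)]
    exact h1.symm

/-- Values of the symbol belong to the spectrum. -/
theorem aeval_freq_mem_constSpectrum (P : ℝ[X]) (ξ₀ : ℝ) :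
    aeval (freq ξ₀) P ∈ constSpectrum P := by
  rintro ⟨C, hC⟩
  set lam := aeval (freq ξ₀) P with hlam
  -- A wave packet concentrated near the frequency `ξ₀` violates the resolvent bound: on its Fourier
  -- support the symbol differs from `lam` by at most `1 / (C + 1)`, and `C / (C + 1) < 1`.
  have hδ : (0 : ℝ) < 1 / (C + 1) := by positivity
  obtain ⟨ε, hε, hball⟩ := Metric.continuous_iff.1 (continuous_aeval_freq P) ξ₀ _ hδ
  let s : Set ℝ := Metric.ball ξ₀ ε
  have hs : MeasurableSet s := measurableSet_ball
  have hsfin : volume s ≠ ⊤ := Metric.isBounded_ball.measure_lt_top.ne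
  let I : L2 := indicatorConstLp 2 hs hsfin 1
  let F : L2 := 𝓕⁻ I
  have hFI : (𝓕 F : L2) = I := FourierTransform.fourier_fourierInv_eq I
  obtain ⟨u, hu, heq, hle, -⟩ := hC F (Lp.memLp F)
  have hsym := (resolvent_eq_iff hu lam F).1 heq
  rw [hFI] at hsym
  have hbound : ∀ᵐ ξ, ‖I ξ‖₊ ≤ (1 / (C + 1)) * ‖(𝓕 (hu.1.toLp u) : L2) ξ‖₊ := by
    filter_upwards [hsym, indicatorConstLp_coeFn (p := 2) (hs := hs) (hμs := hsfin)
      (c := (1 : ℂ))] with ξ h1 h2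
    by_cases hξ : ξ ∈ s
    · rw [h1, nnnorm_mul]
      gcongr
      have := hball ξ hξ
      rw [dist_comm, dist_eq_norm] at this
      exact_mod_cast this.le
    · rw [show I ξ = 0 by rw [h2, Set.indicator_of_notMem hξ]]
      simp
  have h1 := eLpNorm_le_nnreal_smul_eLpNorm_of_ae_le_mul hbound 2
  rw [eLpNorm_fourier, eLpNorm_congr_ae hu.1.coeFn_toLp] at h1
  have h2 : eLpNorm F 2 (volume : Measure ℝ) = eLpNorm I 2 volume := by
    rw [← hFI, eLpNorm_fourier]
  rw [h2] at hle
  have h3 : eLpNorm I 2 volume ≤ ((1 / (C + 1) * C : ℝ≥0) : ℝ≥0∞) * eLpNorm I 2 volume := by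
    refine h1.trans ?_
    rw [ENNReal.smul_def, smul_eq_mul, ENNReal.coe_mul, mul_assoc]
    gcongr
  have hI0 : eLpNorm I 2 volume ≠ 0 := by
    intro h0
    have : I = 0 := by
      rw [← norm_eq_zero, Lp.norm_def, h0, ENNReal.toReal_zero]
    have hn := norm_indicatorConstLp (p := 2) (hs := hs) (hμs := hsfin) (c := (1 : ℂ))
      (by norm_num) (by norm_num)
    rw [show indicatorConstLp 2 hs hsfin (1 : ℂ) = 0 from this, norm_zero] at hn
    have hpos : 0 < volume.real s :=
      ENNReal.toReal_pos (Metric.measure_ball_pos _ _ hε).ne' hsfin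
    have : 0 < ‖(1 : ℂ)‖ * volume.real s ^ (1 / (2 : ℝ≥0∞).toReal) :=
      mul_pos (by simp) (Real.rpow_pos_of_pos hpos _)
    exact this.ne hn
  have hItop : eLpNorm I 2 volume ≠ ⊤ := (Lp.memLp I).eLpNorm_ne_top
  have hlt : ((1 / (C + 1) * C : ℝ≥0) : ℝ≥0∞) < 1 := by
    rw [ENNReal.coe_lt_one_iff, one_div, inv_mul_lt_iff₀ (by positivity), mul_one]
    exact lt_add_one C
  have h4 := ENNReal.mul_lt_mul_left hI0 hItop hlt
  rw [one_mul] at h4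
  exact absurd h3 (not_le.2 h4)

/-- On a compact set continuity suffices because `Q` has no zero on the axis; at infinity the degree
of `Q` dominates. These multiplier bounds give both the resolvent estimate (`k = 0`) and the Sobolev
regularity of the solution. -/
theorem exists_pow_freq_le {Q : ℂ[X]} (hQ : ∀ ξ, Q.eval (freq ξ) ≠ 0) {k : ℕ}
    (hk : k ≤ Q.natDegree) : ∃ C : ℝ≥0, ∀ ξ, ‖freq ξ ^ k / Q.eval (freq ξ)‖ ≤ C := by
  have hcont : Continuous fun ξ => freq ξ ^ k / Q.eval (freq ξ) :=
    (continuous_freq.pow k).div (Q.continuous.comp continuous_freq) hQ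
  have hQ0 : Q ≠ 0 := fun h => hQ 0 (by simp [h])
  have hO : (X ^ k : ℂ[X]).eval =O[Bornology.cobounded ℂ] Q.eval :=
    Polynomial.isBigO_cobounded_of_degree_le (by
      rw [degree_X_pow, degree_eq_natDegree hQ0]; exact_mod_cast hk)
  obtain ⟨c, hc⟩ := hO.bound
  have hfreq : Tendsto freq (cocompact ℝ) (Bornology.cobounded ℂ) := by
    rw [← tendsto_norm_atTop_iff_cobounded]
    have : ∀ ξ, ‖freq ξ‖ = (2 * Real.pi) * ‖ξ‖ := fun ξ => by
      simp [freq, abs_of_pos Real.pi_pos]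
    simp only [this]
    exact tendsto_norm_cocompact_atTop.const_mul_atTop (by positivity)
  have hev := hfreq.eventually hc
  rw [Filter.Eventually, Filter.mem_cocompact] at hev
  obtain ⟨K, hK, hKs⟩ := hev
  obtain ⟨M, hM⟩ := hK.exists_bound_of_continuousOn hcont.continuousOn
  refine ⟨(max M c).toNNReal, fun ξ => ?_⟩
  rw [Real.coe_toNNReal']
  refine le_trans ?_ (le_max_left _ _)
  by_cases hξ : ξ ∈ K
  · exact (hM ξ hξ).trans (le_max_left _ _)
  · have := hKs hξ
    simp only [Set.mem_ofPred_eq, eval_pow, eval_X] at this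
    rw [norm_div, div_le_iff₀ (norm_pos_iff.2 (hQ ξ))]
    exact this.trans (mul_le_mul_of_nonneg_right (le_max_right _ _) (norm_nonneg _))

/-- Points outside the range of the symbol belong to the resolvent set. -/
theorem inResolventSet_of_ne {P : ℝ[X]} {lam : ℂ}
    (h : ∀ ξ, aeval (freq ξ) P ≠ lam) : InResolventSet P.natDegree (constOp P) lam := by
  set Q : ℂ[X] := C lam - P.map (algebraMap ℝ ℂ) with hQdef
  have hQeval : ∀ ξ, Q.eval (freq ξ) = lam - aeval (freq ξ) P := fun ξ => by
    simp [hQdef, aeval_def]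
  have hQ : ∀ ξ, Q.eval (freq ξ) ≠ 0 := fun ξ => by
    rw [hQeval]; exact sub_ne_zero.2 (h ξ).symm
  have hdeg : Q.natDegree = P.natDegree := by
    rw [hQdef, ← neg_sub, natDegree_neg, natDegree_sub_C, natDegree_map]
  have hcont : ∀ k : ℕ, Continuous fun ξ => freq ξ ^ k / Q.eval (freq ξ) := fun k =>
    (continuous_freq.pow k).div (Q.continuous.comp continuous_freq) hQ
  obtain ⟨C₀, hC₀⟩ := exists_pow_freq_le hQ (Nat.zero_le _)
  refine ⟨C₀, fun f hf => ?_⟩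
  set F : L2 := hf.toLp f
  have hmul : ∀ k ≤ P.natDegree,
      MemLp (fun ξ => freq ξ ^ k / Q.eval (freq ξ) * (𝓕 F : L2) ξ) 2 (volume : Measure ℝ) := by
    intro k hk
    obtain ⟨c, hc⟩ := exists_pow_freq_le hQ (hk.trans_eq hdeg.symm)
    refine (Lp.memLp (𝓕 F : L2)).of_le_mul (c := c)
      ((hcont k).aestronglyMeasurable.mul (Lp.memLp (𝓕 F : L2)).1) (ae_of_all _ fun ξ => ?_)
    rw [norm_mul]
    exact mul_le_mul_of_nonneg_right (hc ξ) (norm_nonneg _)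
  -- Division by `lam` minus the symbol on the Fourier side; the factor `freq ξ ^ 0` is trivial.
  set U : L2 := 𝓕⁻ ((hmul 0 (Nat.zero_le _)).toLp _) with hU
  have hUF : (𝓕 U : L2) =ᵐ[volume] fun ξ => freq ξ ^ 0 / Q.eval (freq ξ) * (𝓕 F : L2) ξ := by
    rw [hU, FourierTransform.fourier_fourierInv_eq]
    exact (hmul 0 (Nat.zero_le _)).coeFn_toLp
  have hUH : MemH P.natDegree U := by
    refine memH_of_fourier U fun k hk => (memLp_congr_ae ?_).1 (hmul k hk)
    filter_upwards [hUF] with ξ hξ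
    rw [hξ]; ring
  have hUU : hUH.1.toLp U = U := Lp.toLp_coeFn U _
  have hfF : f =ᵐ[volume] F := hf.coeFn_toLp.symm
  refine ⟨U, hUH, ?_, ?_, fun v hv hveq => ?_⟩
  · refine EventuallyEq.trans ((resolvent_eq_iff hUH lam F).2 ?_) hfF.symm
    rw [hUU]
    filter_upwards [hUF] with ξ hξ
    rw [hξ, ← hQeval]
    field_simp [hQ ξ]
  · rw [eLpNorm_congr_ae hfF, ← eLpNorm_fourier U, ← eLpNorm_fourier F]
    refine (eLpNorm_le_nnreal_smul_eLpNorm_of_ae_le_mul (c := C₀) ?_ 2)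
    filter_upwards [hUF] with ξ hξ
    rw [hξ, nnnorm_mul]
    exact mul_le_mul_left (by exact_mod_cast hC₀ ξ) _
  · have h1 := (resolvent_eq_iff hv lam F).1 (hveq.trans hfF)
    have : hv.1.toLp v = U := by
      refine fourier_injective ?_
      filter_upwards [h1, hUF] with ξ a b
      rw [b, a, ← hQeval]
      field_simp [hQ ξ]
    rw [← this]
    exact hv.1.coeFn_toLp.symm

/-- The spectrum is the range of the symbol: wave packets give one inclusion, division by the symbol
the other. -/
theorem constSpectrum_subset_iff {P : ℝ[X]} (s : ℝ) :
    constSpectrum P ⊆ {lam : ℂ | lam.re ≤ s} ↔ ∀ ξ, (aeval (freq ξ) P).re ≤ s := by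
  refine ⟨fun h ξ => h (aeval_freq_mem_constSpectrum P ξ), fun h lam hlam => ?_⟩
  by_contra hlt
  exact hlam (inResolventSet_of_ne fun ξ e => hlt (by simpa [e] using h ξ))

end Symbols

/-! ### Sobolev spaces and exponential weights -/

section Sobolev

theorem MemH.of_le {n m : ℕ} {u : ℝ → ℂ} (h : MemH n u) (hm : m ≤ n) : MemH m u :=
  ⟨h.1, fun k hk => h.2 k (hk.trans hm)⟩

theorem MemH.add {n : ℕ} {u v : ℝ → ℂ} (hu : MemH n u) (hv : MemH n v) :
    MemH n fun x => u x + v x := by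
  refine ⟨hu.1.add hv.1, fun k hk => ?_⟩
  obtain ⟨g, hg, hug⟩ := hu.2 k hk
  obtain ⟨h, hh, hvh⟩ := hv.2 k hk
  exact ⟨_, hg.add hh, hug.add hvh⟩

theorem MemLp.locallyIntegrable_two {u : ℝ → ℂ} (h : MemLp u 2 (volume : Measure ℝ)) :
    LocallyIntegrable u := h.locallyIntegrable (by norm_num)

theorem memH_zero {u : ℝ → ℂ} (h : MemLp u 2 (volume : Measure ℝ)) : MemH 0 u :=
  ⟨h, fun k hk => ⟨u, h, by
    rw [Nat.le_zero.1 hk]; exact hasWeakDeriv_zero (MemLp.locallyIntegrable_two h)⟩⟩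

/-- This recursive form of the Sobolev space is what permits induction on the order for products
with smooth functions and for exponential conjugation. -/
theorem memH_succ_iff {n : ℕ} {u : ℝ → ℂ} :
    MemH (n + 1) u ↔ MemLp u 2 (volume : Measure ℝ) ∧ ∃ g, HasWeakDeriv 1 u g ∧ MemH n g := by
  constructor
  · intro h
    obtain ⟨g, hg2, hg⟩ := h.2 1 (by omega)
    refine ⟨h.1, g, hg, hg2, fun k hk => ?_⟩
    induction k with
    | zero => exact ⟨g, hg2, hasWeakDeriv_zero hg.2.1⟩
    | succ k ih =>
      obtain ⟨a, -, ha⟩ := ih (by omega)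
      obtain ⟨b, hb2, hb⟩ := h.2 (k + 1 + 1) (by omega)
      -- As derivatives of `u`, `a` has order `k + 1` and `b` order `k + 2`, so `b` is the
      -- derivative of `a`.
      exact ⟨b, hb2, ha.succ ((hg.one_comp ha).of_succ hb)⟩
  · rintro ⟨hu, g, hg, hgH⟩
    refine ⟨hu, fun k hk => ?_⟩
    cases k with
    | zero => exact ⟨u, hu, hasWeakDeriv_zero hg.1⟩
    | succ k =>
      obtain ⟨a, ha2, ha⟩ := hgH.2 k (by omega)
      exact ⟨a, ha2, hg.one_comp ha⟩

theorem memLp_bounded_mul {u : ℝ → ℂ} {m : ℝ → ℝ} (hm : Continuous m) {B : ℝ}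
    (hB : ∀ x, |m x| ≤ B) (hu : MemLp u 2 (volume : Measure ℝ)) :
    MemLp (fun x => (m x : ℂ) * u x) 2 (volume : Measure ℝ) := by
  refine hu.of_le_mul (c := B)
    ((Complex.continuous_ofReal.comp hm).aestronglyMeasurable.mul hu.1) (ae_of_all _ fun x => ?_)
  rw [norm_mul, Complex.norm_real]
  exact mul_le_mul_of_nonneg_right (hB x) (norm_nonneg _)

/-- Multiplication by a smooth function with bounded derivatives preserves `Hⁿ`. -/
theorem MemH.mul_smooth {n : ℕ} {u : ℝ → ℂ} {m : ℝ → ℝ} (hm : ContDiff ℝ ∞ m)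
    (hB : ∀ k, ∃ B, ∀ x, |iteratedDeriv k m x| ≤ B) (hu : MemH n u) :
    MemH n fun x => (m x : ℂ) * u x := by
  induction n generalizing m u with
  | zero =>
    obtain ⟨B, hB⟩ := hB 0
    exact memH_zero (memLp_bounded_mul hm.continuous (by simpa using hB) hu.1)
  | succ n ih =>
    obtain ⟨hu2, g, hg, hgH⟩ := memH_succ_iff.1 hu
    obtain ⟨B, hB0⟩ := hB 0
    refine memH_succ_iff.2 ⟨memLp_bounded_mul hm.continuous (by simpa using hB0) hu2, _,
      hg.mul_smooth hm, (ih (contDiff_infty_iff_deriv.1 hm).2 (fun k => ?_)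
        (hu.of_le n.le_succ)).add (ih hm hB hgH)⟩
    obtain ⟨B, hB⟩ := hB (k + 1)
    exact ⟨B, fun x => by rw [← iteratedDeriv_succ']; exact hB x⟩

/-- A weight that is exponential on both half lines and decays there has bounded derivatives. -/
theorem bounded_iteratedDeriv_of_exp {m : ℝ → ℝ} (hm : ContDiff ℝ ∞ m) {a b : ℝ} (ha : 0 ≤ a)
    (hb : b ≤ 0) (hleft : ∀ x ≤ -1, m x = Real.exp (a * x))
    (hright : ∀ x ≥ 1, m x = Real.exp (b * x)) (k : ℕ) :
    ∃ B, ∀ x, |iteratedDeriv k m x| ≤ B := by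
  have hc : Continuous (iteratedDeriv k m) := (contDiff_iteratedDeriv hm k).continuous
  obtain ⟨M, hM⟩ := (isCompact_Icc (a := (-1 : ℝ)) (b := 1)).exists_bound_of_continuousOn
    hc.continuousOn
  have hexp : ∀ c x : ℝ, c * x ≤ 0 → m =ᶠ[𝓝 x] (fun y => Real.exp (c * y)) →
      |iteratedDeriv k m x| ≤ |c| ^ k := by
    intro c x hcx he
    rw [he.iteratedDeriv_eq k, iteratedDeriv_exp_const_mul, abs_mul, abs_pow, Real.abs_exp]
    exact mul_le_of_le_one_right (by positivity) (Real.exp_le_one_iff.2 hcx)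
  refine ⟨max M (max (|a| ^ k) (|b| ^ k)), fun x => ?_⟩
  rcases lt_or_ge x (-1) with h1 | h1
  · refine (hexp a x (mul_nonpos_of_nonneg_of_nonpos ha (by linarith)) ?_).trans
      ((le_max_left _ _).trans (le_max_right _ _))
    filter_upwards [Iio_mem_nhds h1] with y hy using hleft y (le_of_lt hy)
  rcases lt_or_ge 1 x with h2 | h2
  · refine (hexp b x (mul_nonpos_of_nonpos_of_nonneg hb (by linarith)) ?_).trans
      ((le_max_right _ _).trans (le_max_right _ _))
    filter_upwards [Ioi_mem_nhds h2] with y hy using hright y (le_of_lt hy)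
  · exact (hM x ⟨h1, h2⟩).trans (le_max_left _ _)

/-- Conjugation by an exponential shifts the symbol of `∂ₓ` by the exponent. -/
theorem MemH.exists_fourier_exp {n : ℕ} {v : ℝ → ℂ} (h : MemH n v) (τ : ℝ) (k : ℕ) (hk : k ≤ n) :
    ∃ G : L2, HasWeakDeriv k (fun x => (Real.exp (τ * x) : ℂ) * v x)
        (fun x => (Real.exp (τ * x) : ℂ) * G x) ∧
      (𝓕 G : L2) =ᵐ[volume] fun ξ => (freq ξ + τ) ^ k * (𝓕 (h.1.toLp v) : L2) ξ := by
  have hE : ContDiff ℝ ∞ fun x : ℝ => Real.exp (τ * x) :=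
    Real.contDiff_exp.comp (contDiff_const.mul contDiff_id)
  have hE' : ∀ x, deriv (fun x : ℝ => Real.exp (τ * x)) x = τ * Real.exp (τ * x) := fun x => by
    simpa using congrFun (iteratedDeriv_exp_const_mul 1 τ) x
  induction k generalizing n v with
  | zero =>
    refine ⟨h.1.toLp v, ?_, by simp⟩
    have hl : LocallyIntegrable fun x => (Real.exp (τ * x) : ℂ) * v x := by
      simpa only [Complex.real_smul] using
        (MemLp.locallyIntegrable_two h.1).continuous_smul hE.continuous
    refine (hasWeakDeriv_zero hl).congr_ae .rfl ?_
    filter_upwards [h.1.coeFn_toLp] with x hx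
    rw [hx]
  | succ k ih =>
    obtain ⟨n, rfl⟩ : ∃ l, n = l + 1 := ⟨n - 1, by omega⟩
    obtain ⟨hv2, g, hg, hgH⟩ := memH_succ_iff.1 h
    have hτv : MemH n fun x => (τ : ℂ) * v x := by
      refine MemH.mul_smooth (m := fun _ => τ) contDiff_const (fun k => ?_) (h.of_le n.le_succ)
      cases k with
      | zero => exact ⟨|τ|, fun x => by simp⟩
      | succ k => exact ⟨0, fun x => by simp [iteratedDeriv_const]⟩
    -- The induction passes from `v` to `τ v + v'`, because `(e^{τx} v)' = e^{τx} (τ v + v')`.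
    have hW : MemH n fun x => (τ : ℂ) * v x + g x := hτv.add hgH
    obtain ⟨G, hG, hF⟩ := ih hW (by omega)
    refine ⟨G, HasWeakDeriv.one_comp ?_ hG, ?_⟩
    · refine (hg.mul_smooth hE).congr_ae .rfl (ae_of_all _ fun x => ?_)
      simp only [hE']
      push_cast
      ring
    · have e : hW.1.toLp _ = (τ : ℂ) • h.1.toLp v + hgH.1.toLp g := by
        refine Lp.ext ?_
        filter_upwards [hW.1.coeFn_toLp, Lp.coeFn_add ((τ : ℂ) • h.1.toLp v) (hgH.1.toLp g),
          Lp.coeFn_smul (τ : ℂ) (h.1.toLp v), h.1.coeFn_toLp, hgH.1.coeFn_toLp] with x a b c d f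
        rw [a, b, Pi.add_apply, c, Pi.smul_apply, d, f, smul_eq_mul]
      have e' : (𝓕 (hW.1.toLp _) : L2) = (τ : ℂ) • 𝓕 (h.1.toLp v) + 𝓕 (hgH.1.toLp g) := by
        rw [e]
        change Lp.fourierTransformₗᵢ ℝ ℂ _ = _
        rw [map_add, map_smul]
        rfl
      have hd : HasWeakDeriv 1 (h.1.toLp v) (hgH.1.toLp g) :=
        hg.congr_ae h.1.coeFn_toLp.symm hgH.1.coeFn_toLp.symm
      rw [e'] at hF
      filter_upwards [hF, Lp.coeFn_add ((τ : ℂ) • (𝓕 (h.1.toLp v) : L2)) (𝓕 (hgH.1.toLp g)),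
        Lp.coeFn_smul (τ : ℂ) (𝓕 (h.1.toLp v) : L2), hasWeakDeriv_one_iff_fourier.1 hd]
        with ξ a b c d
      rw [a, b, Pi.add_apply, c, Pi.smul_apply, d, smul_eq_mul, pow_succ, freq]
      ring

end Sobolev

/-! ### The energy argument -/

section Energy

theorem integrable_re_inner (V G : L2) (z : ℂ) (σ : ℝ) :
    Integrable fun x => (z * inner ℂ (V x) (G x) - σ * inner ℂ (V x) (V x)).re :=
  (((L2.integrable_inner (𝕜 := ℂ) V G).const_mul z).sub
    ((L2.integrable_inner (𝕜 := ℂ) V V).const_mul (σ : ℂ))).re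

theorem integral_re_inner (V G : L2) (z : ℂ) (σ : ℝ) :
    ∫ x, (z * inner ℂ (V x) (G x) - σ * inner ℂ (V x) (V x)).re
      = (z * inner ℂ V G - σ * inner ℂ V V).re := by
  have h1 := (L2.integrable_inner (𝕜 := ℂ) V G).const_mul z
  have h2 := (L2.integrable_inner (𝕜 := ℂ) V V).const_mul (σ : ℂ)
  have h3 := integral_re (h1.sub h2)
  have h4 := integral_sub h1 h2
  rw [integral_const_mul, integral_const_mul] at h4
  rw [L2.inner_def, L2.inner_def, ← h4]
  exact h3

/-- A Fourier multiplier cannot act as a multiplication operator with values in a complementary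
half plane. -/
theorem eq_zero_of_symbol_lt {V G : L2} {s p : ℝ → ℂ} (z : ℂ) (σ : ℝ)
    (hF : (𝓕 G : L2) =ᵐ[volume] fun ξ => s ξ * (𝓕 V : L2) ξ)
    (hs : ∀ᵐ ξ, (z * s ξ).re < σ) (hG : G =ᵐ[volume] fun x => p x * V x)
    (hp : ∀ x, σ ≤ (z * p x).re) : V = 0 := by
  have hin : ∀ a c : ℂ, (z * inner ℂ a (c * a) - σ * inner ℂ a a).re
      = ((z * c).re - σ) * ‖a‖ ^ 2 := by
    intro a c
    have h1 : inner ℂ a (c * a) = c * ((‖a‖ ^ 2 : ℝ) : ℂ) := by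
      rw [← smul_eq_mul c a, inner_smul_right, inner_self_eq_norm_sq_to_K]
      simp
    have h2 : inner ℂ a a = ((‖a‖ ^ 2 : ℝ) : ℂ) := by
      rw [inner_self_eq_norm_sq_to_K]
      simp
    rw [h1, h2, ← mul_assoc, ← sub_mul, Complex.re_mul_ofReal, Complex.sub_re, Complex.ofReal_re]
  have hx : 0 ≤ (z * inner ℂ V G - σ * inner ℂ V V).re := by
    rw [← integral_re_inner]
    refine integral_nonneg_of_ae ?_
    filter_upwards [hG] with x hx
    rw [hx, hin]
    exact mul_nonneg (sub_nonneg.2 (hp x)) (by positivity)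
  -- By Plancherel the same form is an integral over frequencies with nonpositive integrand. It must
  -- vanish, and the strict inequality `hs` then forces the transform of `V` to be zero.
  rw [← Lp.inner_fourier_eq V G, ← Lp.inner_fourier_eq V V, ← integral_re_inner] at hx
  have hneg : 0 ≤ᵐ[volume] fun ξ => -(z * inner ℂ ((𝓕 V : L2) ξ) ((𝓕 G : L2) ξ)
      - σ * inner ℂ ((𝓕 V : L2) ξ) ((𝓕 V : L2) ξ)).re := by
    filter_upwards [hF, hs] with ξ h1 h2
    rw [h1, hin, ← neg_mul]
    exact mul_nonneg (by linarith) (by positivity)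
  have hzero := (integral_eq_zero_iff_of_nonneg_ae hneg (integrable_re_inner _ _ z σ).neg).1
    (le_antisymm (by rw [integral_neg]; linarith) (integral_nonneg_of_ae hneg))
  refine fourier_injective ?_
  have h0 : (𝓕 (0 : L2) : L2) = 0 := map_zero (Lp.fourierTransformₗᵢ ℝ ℂ)
  rw [h0]
  filter_upwards [hzero, hF, hs, Lp.coeFn_zero ℂ 2 (volume : Measure ℝ)] with ξ h1 h2 h3 h4
  rw [h4]
  rw [h2, hin] at h1
  rcases mul_eq_zero.1 (neg_eq_zero.1 h1) with h | h
  · exact absurd h (by linarith)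
  · simpa using h

end Energy

/-! ### Bounds on the symbols and on the front -/

section Coefficients

variable {α d : ℝ}

theorem cStar_pos (hα : 0 < α) (hd : 0 < d) : 0 < cStar α d := by
  unfold cStar; positivity

theorem cStar_sq (hα : 0 < α) (hd : 0 < d) : cStar α d ^ 2 = 4 * (d * α) := by
  rw [cStar, mul_pow, Real.sq_sqrt (by positivity)]; norm_num

/-- The critical exponent is the double root of `d τ² + c_* τ + α`. Its square and its product with
`c_*` are what enter `γ_rem`. -/
theorem criticalExponent_sq (hα : 0 < α) (hd : 0 < d) :
    (-(cStar α d / (2 * d))) ^ 2 = α / d := by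
  rw [neg_sq, div_pow, cStar_sq hα hd]
  field_simp
  ring

theorem cStar_mul_criticalExponent (hα : 0 < α) (hd : 0 < d) :
    cStar α d * -(cStar α d / (2 * d)) = -2 * α := by
  have := cStar_sq hα hd
  field_simp
  linarith

theorem aeval_expConj (τ : ℝ) (P : ℝ[X]) (z : ℂ) : aeval z (expConj τ P) = aeval (z + τ) P := by
  rw [expConj, aeval_comp]; simp

theorem aeval_symAkppMinus (z : ℂ) :
    aeval z (symAkppMinus α d) = d * z ^ 2 + cStar α d * z - 2 * α := by
  simp [symAkppMinus]

theorem aeval_symAshMinus (μ : ℝ) (z : ℂ) :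
    aeval z (symAshMinus α d μ) = -(1 + z ^ 2) ^ 2 + cStar α d * z + μ := by
  simp [symAshMinus]

theorem aeval_symAshPlus (μ γ : ℝ) (z : ℂ) :
    aeval z (symAshPlus α d μ γ) = aeval z (symAshMinus α d μ) - γ := by
  simp [symAshPlus]

theorem freq_add (ξ τ : ℝ) : freq ξ + τ = ⟨τ, 2 * Real.pi * ξ⟩ := by
  apply Complex.ext <;> simp [freq]

/-- With `k = 2πξ` the real part is `θ (d θ + c_*) - d k² - 2α`, and `θ < 0 ≤ d θ + c_*`. -/
theorem re_aeval_symAkppMinus_le (hα : 0 < α) (hd : 0 < d) {θ : ℝ}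
    (h1 : -(cStar α d / (2 * d)) ≤ θ) (h2 : θ < 0) (ξ : ℝ) :
    (aeval (freq ξ + θ) (symAkppMinus α d)).re ≤ -(2 * α) := by
  have hc := cStar_pos hα hd
  have h3 : 0 ≤ d * θ + cStar α d := by
    have := mul_le_mul_of_nonneg_left h1 hd.le
    have e : d * -(cStar α d / (2 * d)) = -(cStar α d / 2) := by field_simp
    linarith
  have h4 : θ * (d * θ + cStar α d) ≤ 0 := mul_nonpos_of_nonpos_of_nonneg h2.le h3
  have h5 : 0 ≤ d * (2 * Real.pi * ξ) ^ 2 := by positivity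
  rw [aeval_symAkppMinus, freq_add]
  simp only [pow_two, Complex.add_re, Complex.sub_re, Complex.mul_re, Complex.mul_im,
    Complex.ofReal_re, Complex.ofReal_im, Complex.re_ofNat, Complex.im_ofNat]
  linarith

/-- Completing the square in `k²`, where `k = 2πξ`: the difference of the two sides is `(k² - (1 +
3τ²))²`, so the bound is sharp. -/
theorem re_aeval_symAshMinus_le (μ τ ξ : ℝ) :
    (aeval (freq ξ + τ) (symAshMinus α d μ)).re
      ≤ 8 * (τ ^ 2) ^ 2 + 4 * τ ^ 2 + cStar α d * τ + μ := by
  rw [aeval_symAshMinus, freq_add]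
  simp only [pow_two, Complex.add_re, Complex.add_im, Complex.neg_re, Complex.mul_re,
    Complex.mul_im, Complex.ofReal_re, Complex.ofReal_im, Complex.one_re, Complex.one_im]
  nlinarith [sq_nonneg ((2 * Real.pi * ξ) ^ 2 - (1 + 3 * τ ^ 2))]

theorem spectralGap_iff {μ γ θ η : ℝ} : SpectralGap α d μ γ θ η ↔
    (∀ ξ, (aeval (freq ξ + θ) (symAkppMinus α d)).re ≤ -3 * η) ∧
    (∀ ξ, (aeval (freq ξ + (-(cStar α d / (2 * d)) : ℝ)) (symAshPlus α d μ γ)).re ≤ -3 * η) ∧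
    ∀ ξ, (aeval (freq ξ + θ) (symAshMinus α d μ)).re ≤ -3 * η := by
  simp only [SpectralGap, Set.union_subset_iff, constSpectrum_subset_iff, aeval_expConj, and_assoc]

/-- A front stays below the state it invades from. -/
theorem IsCriticalFront.le_one {q : ℝ → ℝ} (hα : 0 < α) (hd : 0 < d)
    (hq : IsCriticalFront α d q) (x : ℝ) : q x ≤ 1 := by
  by_contra! hx
  -- Both limits lie below `q x > 1`, so a global maximum is attained.
  obtain ⟨y, hy⟩ := hq.contDiff.continuous.exists_forall_ge' x (by
    rw [cocompact_eq_atBot_atTop, eventually_sup]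
    exact ⟨(hq.atBot.eventually_lt_const hx).mono fun _ => le_of_lt,
      (hq.atTop.eventually_lt_const (zero_lt_one.trans hx)).mono fun _ => le_of_lt⟩)
  have hy1 : 1 < q y := hx.trans_le (hy x)
  have hmax : IsLocalMax q y := Eventually.of_forall hy
  have hode := hq.ode y
  rw [iteratedDeriv_succ, iteratedDeriv_one, hmax.deriv_eq_zero] at hode
  have hpos : 0 < deriv (deriv q) y := by
    have h1 : 0 < α * q y * (q y ^ 2 - 1) := by
      have : 0 < q y ^ 2 - 1 := by nlinarith
      positivity
    by_contra! h
    have := mul_nonpos_of_nonneg_of_nonpos hd.le h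
    nlinarith
  -- At the maximum the equation gives `d q'' = α q (q² - 1) > 0`, so `y` is also a local minimum;
  -- then `q` is constant near `y`, against `q'' > 0`.
  have hmin := isLocalMin_of_deriv_deriv_pos hpos hmax.deriv_eq_zero
    hq.contDiff.continuous.continuousAt
  have hconst : q =ᶠ[𝓝 y] fun _ => q y := by
    filter_upwards [hmin] with t ht using le_antisymm (hy t) ht
  have := hconst.deriv.deriv_eq
  simp at this
  exact hpos.ne' this

end Coefficients

/-! ### Absence of eigenvalues -/

section Eigenfunctions

variable {α d μ γ : ℝ} {q : ℝ → ℝ}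

theorem weakDeriv_exp_ae {k : ℕ} {τ : ℝ} {v G : ℝ → ℂ}
    (h : HasWeakDeriv k (fun x => (Real.exp (τ * x) : ℂ) * v x)
      fun x => (Real.exp (τ * x) : ℂ) * G x) :
    weakDeriv k (fun x => (Real.exp (τ * x) : ℂ) * v x) =ᵐ[volume]
      fun x => (Real.exp (τ * x) : ℂ) * G x :=
  (weakDeriv_spec h).ae_eq h

theorem ofReal_exp_ne_zero (y : ℝ) : (Real.exp y : ℂ) ≠ 0 :=
  Complex.ofReal_ne_zero.2 (Real.exp_ne_zero y)

/-- The eigenvalue equation of the Swift-Hohenberg block after conjugation by an exponential. -/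
theorem exists_fourier_opAsh {v : ℝ → ℂ} (hv : MemH 4 v) (τ : ℝ) {lam : ℂ}
    (h : opAsh α d μ γ q (fun x => (Real.exp (τ * x) : ℂ) * v x) =ᵐ[volume]
      fun x => lam * ((Real.exp (τ * x) : ℂ) * v x)) :
    ∃ G : L2, (𝓕 G : L2) =ᵐ[volume] (fun ξ => aeval (freq ξ + τ) (symAshMinus α d μ)
        * (𝓕 (hv.1.toLp v) : L2) ξ) ∧
      G =ᵐ[volume] fun x => (lam + (γ * (1 - q x) : ℝ)) * (hv.1.toLp v) x := by
  obtain ⟨G₁, w₁, f₁⟩ := hv.exists_fourier_exp τ 1 (by norm_num)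
  obtain ⟨G₂, w₂, f₂⟩ := hv.exists_fourier_exp τ 2 (by norm_num)
  obtain ⟨G₄, w₄, f₄⟩ := hv.exists_fourier_exp τ 4 (by norm_num)
  set V : L2 := hv.1.toLp v with hV
  let c : Fin 4 → ℂ := ![-1, -2, cStar α d, μ - 1]
  let H : Fin 4 → L2 := ![G₄, G₂, G₁, V]
  refine ⟨∑ j, c j • H j, ?_, ?_⟩
  · rw [fourier_sum_smul]
    filter_upwards [coeFn_sum_smul Finset.univ c fun j => 𝓕 (H j), f₁, f₂, f₄] with ξ hs h1 h2 h4
    rw [hs, Fin.sum_univ_four]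
    simp only [c, H, Matrix.cons_val]
    rw [h1, h2, h4, aeval_symAshMinus]
    ring
  · filter_upwards [coeFn_sum_smul Finset.univ c H, weakDeriv_exp_ae w₁, weakDeriv_exp_ae w₂,
      weakDeriv_exp_ae w₄, h, hv.1.coeFn_toLp] with x hs h1 h2 h4 he hvx
    rw [hs, Fin.sum_univ_four]
    simp only [c, H, Matrix.cons_val]
    rw [opAsh, h1, h2, h4, ← hvx, ← hV] at he
    refine mul_left_cancel₀ (ofReal_exp_ne_zero (τ * x)) ?_
    push_cast at he ⊢
    linear_combination he

/-- The eigenvalue equation of the KPP block after conjugation by the critical exponential. -/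
theorem exists_fourier_opAkpp (hα : 0 < α) (hd : 0 < d) {v : ℝ → ℂ} (hv : MemH 2 v) {lam : ℂ}
    (h : opAkpp α d q (fun x => (Real.exp (-(cStar α d / (2 * d)) * x) : ℂ) * v x) =ᵐ[volume]
      fun x => lam * ((Real.exp (-(cStar α d / (2 * d)) * x) : ℂ) * v x)) :
    ∃ G : L2, (𝓕 G : L2) =ᵐ[volume] (fun ξ => ((-(d * (2 * Real.pi * ξ) ^ 2) : ℝ) : ℂ)
        * (𝓕 (hv.1.toLp v) : L2) ξ) ∧
      G =ᵐ[volume] fun x => (lam + (3 * α * q x ^ 2 : ℝ)) * (hv.1.toLp v) x := by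
  obtain ⟨G₁, w₁, f₁⟩ := hv.exists_fourier_exp (-(cStar α d / (2 * d))) 1 (by norm_num)
  obtain ⟨G₂, w₂, f₂⟩ := hv.exists_fourier_exp (-(cStar α d / (2 * d))) 2 (by norm_num)
  have e1 := criticalExponent_sq hα hd
  have e2 := cStar_mul_criticalExponent hα hd
  have e3 : 2 * d * -(cStar α d / (2 * d)) = -cStar α d := by field_simp
  set τ := -(cStar α d / (2 * d)) with hτ
  set V : L2 := hv.1.toLp v with hV
  let c : Fin 3 → ℂ := ![d, cStar α d, α]
  let H : Fin 3 → L2 := ![G₂, G₁, V]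
  refine ⟨∑ j, c j • H j, ?_, ?_⟩
  · rw [fourier_sum_smul]
    filter_upwards [coeFn_sum_smul Finset.univ c fun j => 𝓕 (H j), f₁, f₂] with ξ hs h1 h2
    rw [hs, Fin.sum_univ_three]
    simp only [c, H, Matrix.cons_val]
    rw [h1, h2]
    -- The double root cancels the zeroth- and first-order terms of `d (τ + ik)² + c_* (τ + ik) +
    -- α`, leaving the real symbol `-d k²`.
    have k1 : (d : ℂ) * τ ^ 2 = α := by
      rw [← Complex.ofReal_pow, e1, ← Complex.ofReal_mul, mul_div_cancel₀ _ hd.ne']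
    have k2 : (cStar α d : ℂ) * τ = -2 * α := by
      rw [← Complex.ofReal_mul, e2]; push_cast; ring
    have k3 : 2 * (d : ℂ) * τ = -cStar α d := by
      rw [← Complex.ofReal_neg, ← e3]; push_cast; ring
    have k4 : freq ξ ^ 2 = -(2 * Real.pi * ξ) ^ 2 := by
      rw [freq]; ring_nf; rw [Complex.I_sq]; ring
    push_cast
    linear_combination (𝓕 V : L2) ξ * (k1 + k2 + freq ξ * k3 + d * k4)
  · filter_upwards [coeFn_sum_smul Finset.univ c H, weakDeriv_exp_ae w₁, weakDeriv_exp_ae w₂,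
      h, hv.1.coeFn_toLp] with x hs h1 h2 he hvx
    rw [hs, Fin.sum_univ_three]
    simp only [c, H, Matrix.cons_val]
    rw [opAkpp, h1, h2, ← hvx, ← hV] at he
    refine mul_left_cancel₀ (ofReal_exp_ne_zero (τ * x)) ?_
    push_cast at he ⊢
    linear_combination he

/-- The potential `γ (1 - q) ≥ 0` only pushes the multiplication side further right, so `Re λ`
separates it from the symbol. -/
theorem ae_eq_zero_of_opAsh {v : ℝ → ℂ} (hv : MemH 4 v) {τ : ℝ} {lam : ℂ} (hγ : 0 < γ)
    (hq : ∀ x, q x ≤ 1)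
    (hs : ∀ ξ, (aeval (freq ξ + τ) (symAshMinus α d μ)).re < lam.re)
    (h : opAsh α d μ γ q (fun x => (Real.exp (τ * x) : ℂ) * v x) =ᵐ[volume]
      fun x => lam * ((Real.exp (τ * x) : ℂ) * v x)) : v =ᵐ[volume] 0 := by
  obtain ⟨G, hF, hG⟩ := exists_fourier_opAsh hv τ h
  have h0 : hv.1.toLp v = 0 := by
    refine eq_zero_of_symbol_lt 1 lam.re hF (ae_of_all _ fun ξ => by simpa using hs ξ) hG
      fun x => ?_
    have := mul_nonneg hγ.le (sub_nonneg.2 (hq x))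
    rw [one_mul, Complex.add_re, Complex.ofReal_re]
    linarith
  rw [← MemLp.toLp_zero (MemLp.zero (p := 2) (μ := (volume : Measure ℝ)) (ε := ℂ)),
    MemLp.toLp_eq_toLp_iff] at h0
  exact h0

/-- After conjugation both the symbol `-d k²` and the potential `3α q²` are real with favourable
sign, whatever the shape of the front. -/
theorem ae_eq_zero_of_opAkpp (hα : 0 < α) (hd : 0 < d) {v : ℝ → ℂ} (hv : MemH 2 v) {lam : ℂ}
    (hlam : ¬ (lam.im = 0 ∧ lam.re < 0))
    (h : opAkpp α d q (fun x => (Real.exp (-(cStar α d / (2 * d)) * x) : ℂ) * v x) =ᵐ[volume]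
      fun x => lam * ((Real.exp (-(cStar α d / (2 * d)) * x) : ℂ) * v x)) : v =ᵐ[volume] 0 := by
  obtain ⟨G, hF, hG⟩ := exists_fourier_opAkpp hα hd hv h
  have h0 : hv.1.toLp v = 0 := by
    by_cases him : lam.im = 0
    · have hre : 0 ≤ lam.re := not_lt.1 fun h => hlam ⟨him, h⟩
      refine eq_zero_of_symbol_lt 1 0 hF ?_ hG fun x => ?_
      -- The symbol vanishes only at zero frequency, a null set; this handles `λ = 0` as well.
      · filter_upwards [Measure.ae_ne volume (0 : ℝ)] with ξ hξ
        rw [one_mul, Complex.ofReal_re]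
        have : 0 < d * (2 * Real.pi * ξ) ^ 2 := by positivity
        linarith
      · have : 0 ≤ 3 * α * q x ^ 2 := by positivity
        rw [one_mul, Complex.add_re, Complex.ofReal_re]
        linarith
    · have hpos : 0 < lam.im ^ 2 := by positivity
      -- Multiplication by `-i Im λ` makes the real symbol purely imaginary and gives `λ + 3α q²`
      -- the real part `(Im λ)²`, whatever the sign of `Im λ`.
      refine eq_zero_of_symbol_lt (-Complex.I * lam.im) (lam.im ^ 2) hF
        (ae_of_all _ fun ξ => ?_) hG fun x => ?_
      · generalize -(d * (2 * Real.pi * ξ) ^ 2) = r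
        simpa using hpos
      · simp [pow_two]
  rw [← MemLp.toLp_zero (MemLp.zero (p := 2) (μ := (volume : Measure ℝ)) (ε := ℂ)),
    MemLp.toLp_eq_toLp_iff] at h0
  exact h0

/-- A weighted function written as an exponential times a function of the same regularity. -/
theorem MemH.weight_eq_exp_mul {n : ℕ} {φ : ℝ → ℂ} (hφ : MemH n φ) {w : ℝ → ℝ}
    (hw : ContDiff ℝ ∞ w) (hpos : ∀ x, 0 < w x) {a b τ : ℝ} (ha : τ ≤ a) (hb : b ≤ τ)
    (hleft : ∀ x ≤ -1, w x = Real.exp (a * x)) (hright : ∀ x ≥ 1, w x = Real.exp (b * x)) :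
    ∃ v : ℝ → ℂ, MemH n v ∧ (∀ x, (w x : ℂ) * φ x = (Real.exp (τ * x) : ℂ) * v x) ∧
      (v =ᵐ[volume] 0 → φ =ᵐ[volume] 0) := by
  have hE : ContDiff ℝ ∞ fun x : ℝ => Real.exp (-τ * x) :=
    Real.contDiff_exp.comp (contDiff_const.mul contDiff_id)
  -- The multiplier `e^{-τx} w` has exponents `a - τ ≥ 0` on the left and `b - τ ≤ 0` on the right,
  -- so all its derivatives are bounded.
  refine ⟨fun x => ((Real.exp (-τ * x) * w x : ℝ) : ℂ) * φ x,
    hφ.mul_smooth (hE.mul hw) (bounded_iteratedDeriv_of_exp (hE.mul hw) (a := a - τ) (b := b - τ)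
      (by linarith) (by linarith) (fun x hx => ?_) fun x hx => ?_), fun x => ?_, fun h => ?_⟩
  · rw [hleft x hx, ← Real.exp_add]; ring_nf
  · rw [hright x hx, ← Real.exp_add]; ring_nf
  · rw [← mul_assoc, ← Complex.ofReal_mul, ← mul_assoc, ← Real.exp_add]
    simp
  · filter_upwards [h] with x hx
    refine (mul_eq_zero.1 hx).resolve_left (Complex.ofReal_ne_zero.2 ?_)
    exact (mul_pos (Real.exp_pos _) (hpos x)).ne'

theorem conjOp_eigen {w : ℝ → ℝ} (hpos : ∀ x, 0 < w x) {A : (ℝ → ℂ) → ℝ → ℂ} {φ v : ℝ → ℂ}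
    {τ : ℝ} {lam : ℂ} (hv : ∀ x, (w x : ℂ) * φ x = (Real.exp (τ * x) : ℂ) * v x)
    (h : conjOp w A φ =ᵐ[volume] fun x => lam * φ x) :
    A (fun x => (Real.exp (τ * x) : ℂ) * v x) =ᵐ[volume]
      fun x => lam * ((Real.exp (τ * x) : ℂ) * v x) := by
  filter_upwards [h] with x hx
  have hw : (w x : ℂ) ≠ 0 := Complex.ofReal_ne_zero.2 (hpos x).ne'
  simp only [conjOp, hv] at hx
  rw [← hv x, ← mul_assoc, mul_comm lam, mul_assoc, ← hx, mul_inv_cancel_left₀ hw]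

/-- The weighted linearization about a critical front has no eigenvalue to the right of the gap
off the negative half line. -/
theorem not_isEigenvalue_opL (hα : 0 < α) (hd : 0 < d) {θ η β : ℝ}
    (hθ : -(cStar α d / (2 * d)) ≤ θ) (hγ : 0 < γ)
    (hgap : SpectralGap α d μ γ θ η) {ωkpp ωsh : ℝ → ℝ} (hq : IsCriticalFront α d q)
    (hk : IsKppWeight α d ωkpp) (hsh : IsShWeight θ ωsh) {lam : ℂ} (hlam : lam ∈ OmegaEig η) :
    ¬ IsEigenvalue (opL α β d μ γ q fun x => ωkpp x * ωsh x) lam := by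
  rintro ⟨φ, h1, h2, hne, e1, e2⟩
  have hw : ContDiff ℝ ∞ fun x => ωkpp x * ωsh x := hk.contDiff.mul hsh.contDiff
  have hpos : ∀ x, 0 < ωkpp x * ωsh x := fun x => mul_pos (hk.pos x) (hsh.pos x)
  have hleft : ∀ x ≤ -1, ωkpp x * ωsh x = Real.exp (θ * x) := fun x hx => by
    rw [hk.left x hx, hsh.left x hx, one_mul]
  have hright : ∀ x ≥ 1, ωkpp x * ωsh x = Real.exp (-(cStar α d / (2 * d)) * x) := fun x hx => by
    rw [hk.right x hx, hsh.right x hx, mul_one]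
  have hφ2 : φ.2 =ᵐ[volume] 0 := by
    obtain ⟨v, hv, hwv, h0⟩ := h2.weight_eq_exp_mul hw hpos le_rfl hθ hleft hright
    exact h0 (ae_eq_zero_of_opAsh hv hγ (hq.le_one hα hd)
      (fun ξ => ((spectralGap_iff.1 hgap).2.2 ξ).trans_lt hlam.1) (conjOp_eigen hpos hwv e2))
  have hφ1 : φ.1 =ᵐ[volume] 0 := by
    obtain ⟨v, hv, hwv, h0⟩ := h1.weight_eq_exp_mul hw hpos hθ le_rfl hleft hright
    refine h0 (ae_eq_zero_of_opAkpp hα hd hv hlam.2 (q := q) (conjOp_eigen hpos hwv ?_))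
    filter_upwards [e1, hφ2] with x hx hz
    simpa [opL, hz] using hx
  exact hne ⟨hφ1, hφ2⟩

/-- A weight exponent that stabilizes the Swift-Hohenberg symbol uniformly in a small parameter. -/
theorem exists_stable_exponent (hα : 0 < α) (hd : 0 < d) :
    ∃ ε > 0, ε ≤ cStar α d / (2 * d) ∧
      8 * ((-ε) ^ 2) ^ 2 + 4 * (-ε) ^ 2 + cStar α d * -ε ≤ -(2 * (cStar α d * ε / 4)) := by
  have hc := cStar_pos hα hd
  -- `ε ≤ 1` bounds the quartic and quadratic terms by `12 ε²`, and `ε ≤ c_*/24` bounds this by half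
  -- of `c_* ε`.
  refine ⟨min (cStar α d / (2 * d)) (min 1 (cStar α d / 24)), by positivity, min_le_left _ _, ?_⟩
  set ε := min (cStar α d / (2 * d)) (min 1 (cStar α d / 24)) with hε
  have h0 : 0 < ε := by positivity
  have h1 : ε ≤ 1 := (min_le_right _ _).trans (min_le_left _ _)
  have h2 : ε ≤ cStar α d / 24 := (min_le_right _ _).trans (min_le_right _ _)
  have h3 : ε ^ 2 ≤ 1 := pow_le_one₀ h0.le h1
  have h4 : (ε ^ 2) ^ 2 ≤ ε ^ 2 := by nlinarith [sq_nonneg ε]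
  have h5 : ε * ε ≤ ε * (cStar α d / 24) := mul_le_mul_of_nonneg_left h2 h0.le
  rw [neg_sq]
  nlinarith

end Eigenfunctions

end FrontSpectrum

/-! ### The proposition -/

open FrontSpectrum in
theorem mainTheorem7 (α d : ℝ) (hα : 0 < α) (hd : 0 < d) :
    ∃ μbar : ℝ, 0 < μbar ∧ ∀ μ₀ : ℝ, 0 < μ₀ → μ₀ ≤ μbar →
      -- the exponent `θ` of the weight (depending on `μ`) and, for each `γ`, a gap `η` that is
      -- uniform in `μ` exist
      (∃ θ : ℝ → ℝ,
        (∀ μ, 0 < μ → μ < μ₀ → -(cStar α d / (2 * d)) ≤ θ μ ∧ θ μ < 0) ∧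
        ∀ γ, 0 < γ → gammaRem α d μ₀ < γ →
          ∃ η, 0 < η ∧ ∀ μ, 0 < μ → μ < μ₀ → SpectralGap α d μ γ (θ μ) η) ∧
      -- for every such choice, `L` has no eigenvalue in `OmegaEig η`
      (∀ μ, 0 < μ → μ < μ₀ → ∀ θ, -(cStar α d / (2 * d)) ≤ θ → θ < 0 →
        ∀ γ, 0 < γ → gammaRem α d μ₀ < γ →
        ∀ η, 0 < η → SpectralGap α d μ γ θ η →
        ∀ (β : ℝ) (q ωkpp ωsh : ℝ → ℝ), IsCriticalFront α d q →
          IsKppWeight α d ωkpp → IsShWeight θ ωsh →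
          ∀ lam ∈ OmegaEig η,
            ¬ IsEigenvalue (opL α β d μ γ q (fun x => ωkpp x * ωsh x)) lam) := by
  obtain ⟨ε, hε, hεc, hε'⟩ := exists_stable_exponent hα hd
  have hc := cStar_pos hα hd
  -- The threshold is half of the margin `c_* ε / 2`; the other half remains as a gap uniform in
  -- `μ`, with the constant choice `θ = -ε`.
  refine ⟨cStar α d * ε / 4, by positivity, fun μ₀ hμ₀ hμbar => ⟨⟨fun _ => -ε,
    fun _ _ _ => ⟨neg_le_neg hεc, neg_lt_zero.2 hε⟩, fun γ _ hγrem => ?_⟩,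
    fun μ _ _ θ hθ _ γ hγ _ η _ hgap β q ωkpp ωsh hq hk hsh lam hlam =>
      not_isEigenvalue_opL hα hd hθ hγ hgap hq hk hsh hlam⟩⟩
  -- One entry for each asymptotic operator, in the order of the gap condition.
  set η := min (2 * α) (min (γ - gammaRem α d μ₀) (cStar α d * ε / 4)) / 3 with hη
  have h3η : -3 * η = -min (2 * α) (min (γ - gammaRem α d μ₀) (cStar α d * ε / 4)) := by
    rw [hη]; ring
  have hγ' := sub_pos.2 hγrem
  refine ⟨η, by positivity, fun μ hμ hμμ₀ => spectralGap_iff.2 ⟨fun ξ => ?_, fun ξ => ?_,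
    fun ξ => ?_⟩⟩
  · rw [h3η]
    exact (re_aeval_symAkppMinus_le hα hd (neg_le_neg hεc) (neg_lt_zero.2 hε) ξ).trans
      (neg_le_neg (min_le_left _ _))
  · rw [h3η]
    refine le_trans ?_ (neg_le_neg ((min_le_right _ _).trans (min_le_left _ _)))
    have h1 := re_aeval_symAshMinus_le (α := α) (d := d) μ (-(cStar α d / (2 * d))) ξ
    rw [criticalExponent_sq hα hd, cStar_mul_criticalExponent hα hd] at h1
    rw [aeval_symAshPlus, Complex.sub_re, Complex.ofReal_re, gammaRem]
    linarith
  · rw [h3η]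
    refine le_trans ?_ (neg_le_neg ((min_le_right _ _).trans (min_le_right _ _)))
    have h1 := re_aeval_symAshMinus_le (α := α) (d := d) μ (-ε) ξ
    linarith
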